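/- Let $\mathbb{F}_q$ be a finite field with $q$ elements and characteristic $p$, let $d\ge 0$ and $s<0$ be integers, put $k=-s$, and let $$\widetilde S_d(s)=\sum_{a}\frac1{a^{s}}\in\mathbb{F}_q(t),$$ where $a$ runs over the monic polynomials of degree $d$ in $\mathbb{F}_q[t]$ that are prime to $v=t$. Write $k=m_0\oplus\cdots\oplus m_d$ if $k=m_0+\cdots+m_d$ with integers $m_i\ge 0$ and this addition involves no carry of digits in base $p$. Let $U_d(k)$ be the set of all $(m_0,\dots,m_d)$ with $k=m_0\oplus\cdots\oplus m_d$ such that $m_i>0$ and $(q-1)\mid m_i$ for $1\le i\le d$. Let $\widetilde U_d(k)$ be defined in the same way, except that for $d\ge1$ the last entry $m_d$ is also allowed to be $0$. The modest element of $U_d(k)$ (if this set is non-empty) is the element $(M_0,\dots,M_d)$ for which $(M_d,M_{d-1},\dots,M_0)$ is lexicographically largest. Assume $\widetilde S_d(s)\ne0$. Then $$\widetilde S_d(s)=(-1)^d\sum_{(m_0,\dots,m_d)\in\widetilde U_d(k)}\binom{k}{m_0,\dots,m_d}\,t^{\,dm_0+(d-1)m_1+\cdots+m_{d-1}},$$ all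 summands on the right are non-zero, and there is exactly one $(m_0,\dots,m_d)\in\widetilde U_d(k)$ whose summand attains the minimal degree in $t$ among all the summands. It is the modest element of $U_d(k)$ if $U_d(k)\neq\emptyset$; otherwise $d\ge1$ and it is $(M_0,\dots,M_{d-1},0)$, where $(M_0,\dots,M_{d-1})$ is the modest element of $U_{d-1}(k)$. If moreover $q=p$ and $d\ge1$, then $(m_0,\dots,m_{d-2},m_{d-1}+m_d)$ is the modest element of $U_{d-1}(k)$. -/

import Mathlib

namespace VadicPowerSum

open Polynomial

/-- There are only finitely many monic polynomials of degree `d` over a finite field,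
so the sum in `primeToPowerSum` below is an honest finite sum. -/
theorem finite_monic_coprime {F : Type*} [Field F] [Finite F] (v : F[X]) (d : ℕ) :
    {a : F[X] | a.Monic ∧ a.natDegree = d ∧ IsCoprime a v}.Finite := by
  have hinj : Function.Injective
      (fun (a : {a : F[X] | a.Monic ∧ a.natDegree = d ∧ IsCoprime a v}) =>
        (fun i : Fin (d + 1) => a.1.coeff i)) := by
    rintro ⟨a, ha, had, _⟩ ⟨b, hb, hbd, _⟩ hab
    apply Subtype.ext
    ext n
    by_cases hn : n < d + 1
    · exact congrFun hab ⟨n, hn⟩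
    · change a.coeff n = b.coeff n
      rw [coeff_eq_zero_of_natDegree_lt (by omega), coeff_eq_zero_of_natDegree_lt (by omega)]
  exact Set.finite_coe_iff.mp (Finite.of_injective _ hinj)

/-- The power sum `S̃_d(s) = ∑ 1 / a ^ s` over the monic `a ∈ F[t]` of degree `d` that are prime
to `v`, as an element of the rational function field `F(t)`. -/
noncomputable def primeToPowerSum {F : Type*} [Field F] [Finite F] (v : F[X]) (d : ℕ) (s : ℤ) :
    RatFunc F :=
  ∑ a ∈ (finite_monic_coprime v d).toFinset, 1 / (algebraMap F[X] (RatFunc F) a) ^ s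

/-- The sum of the entries of `m` involves no carry of digits in base `p`: in every position `j`
the digits of the entries add up to less than `p`. -/
def NoCarry (p : ℕ) {n : ℕ} (m : Fin n → ℕ) : Prop :=
  ∀ j : ℕ, ∑ i, m i / p ^ j % p < p

open Classical in
/-- `U_d(k)`: tuples `(m_0, …, m_d)` of natural numbers with sum `k`, without carry in base `p`,
such that `m_i` is positive and divisible by `q - 1` for `1 ≤ i ≤ d`. -/
noncomputable def U (p q d k : ℕ) : Finset (Fin (d + 1) → ℕ) :=
  (Finset.piAntidiag Finset.univ k).filter fun m =>
    NoCarry p m ∧ ∀ i, i ≠ 0 → 0 < m i ∧ (q - 1) ∣ m i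

open Classical in
/-- The index set of the expansion of `S̃_d(-k)` for `v = t`: as `U_d(k)`, except that (for `d ≥ 1`)
the last entry `m_d` may be zero. -/
noncomputable def Utilde (p q d k : ℕ) : Finset (Fin (d + 1) → ℕ) :=
  (Finset.piAntidiag Finset.univ k).filter fun m =>
    NoCarry p m ∧ ∀ i, i ≠ 0 → (i ≠ Fin.last d → 0 < m i) ∧ (q - 1) ∣ m i

/-- The summand `(-1)^d * (m_0 + ⋯ + m_d choose m_0, …, m_d) * t^(d m_0 + (d-1) m_1 + ⋯ + m_{d-1})`
of the expansion that is indexed by `m`. -/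
noncomputable def summand (F : Type*) [Field F] {d : ℕ} (m : Fin (d + 1) → ℕ) : F[X] :=
  (-1) ^ d * (Nat.multinomial Finset.univ m : F[X]) * X ^ (∑ i : Fin (d + 1), (d - (i : ℕ)) * m i)

/-- `M` is the modest element of `S`: the reversed tuple `(M_d, …, M_0)` is lexicographically
the largest among the reversed tuples of elements of `S`. -/
def IsModest {n : ℕ} (S : Finset (Fin n → ℕ)) (M : Fin n → ℕ) : Prop :=
  M ∈ S ∧ ∀ m ∈ S, m ≠ M → ∃ j, m j < M j ∧ ∀ i, j < i → m i = M i

/-- `m` is the modest element of `U_d(k)`, or `U_d(k)` is empty, `d ≥ 1` and `m` is the modest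
element of `U_{d-1}(k)` followed by a zero. -/
def IsModifiedModest (p q k : ℕ) : (d : ℕ) → (Fin (d + 1) → ℕ) → Prop
  | 0, m => IsModest (U p q 0 k) m
  | d + 1, m => IsModest (U p q (d + 1) k) m ∨
      (U p q (d + 1) k = ∅ ∧
        ∃ M : Fin (d + 1) → ℕ, IsModest (U p q d k) M ∧ m = Fin.snoc (α := fun _ => ℕ) M 0)

/-- `m` arises from the modest element of `U_{d-1}(k)` by splitting its last entry in two,
i.e. `(m_0, …, m_{d-2}, m_{d-1} + m_d)` is the modest element of `U_{d-1}(k)`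
(no condition if `d = 0`). -/
def IsSplitOfModest (p q k : ℕ) : (d : ℕ) → (Fin (d + 1) → ℕ) → Prop
  | 0, _ => True
  | d + 1, m => IsModest (U p q d k) fun i : Fin (d + 1) =>
      if i = Fin.last d then m i.castSucc + m (Fin.last (d + 1)) else m i.castSucc

end VadicPowerSum

namespace VadicPowerSum

/-! Expanding `a ^ k` multinomially and summing over each coefficient of `a` gives the formula: a
power sum over `F` is `-1` or `0`, and by Legendre's formula a multinomial coefficient is nonzero
mod `p` exactly when there is no carry. Since `∑ (d - i) m_i = d k - ∑ i m_i`, minimal degree means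
maximal weight `∑ i m_i`. It remains to show that a tuple of maximal weight is lexicographically
largest from the top, hence unique.

A carry-free sum is a division of the multiset `dig p k` of digit positions into classes. With `q =
p ^ f`, a class has value divisible by `q - 1` iff its sizes, obtained by rotating the positions mod
`f`, are multiples of `q - 1`. The quotients form a vector `α` with `p α_j = α_{j+1} + (number of
positions of type -(j+1))`, so blocks can be split off by inequalities between such vectors
(`exists_split`). The positions `complement p f k` turn class `0` into a block too, and the top
class stays free.

The core is `Optimal.not_feasible`. Suppose a position `e` below the top class could be moved there,
judging by sizes alone. For the largest such `e`, `bubble` carries `e` up through the classes so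
that only positions below `e` move down, each by at most one class. The gain `p ^ e` exceeds the
total loss, because the positions below `e` are worth less than `p ^ e`. So the top class of an
optimal division has maximal value (`Optimal.pval_top_le`), and induction on `d` gives
`Optimal.lex`.

For `q = p` a block is a nonempty class of cardinality divisible by `p - 1`. Exchanges then show
that an optimal division cuts the sorted digits into pieces of prescribed lengths, and these do not
depend on `d` below the last two classes. -/

/-- The value of a multiset of positions, each position `x` standing for the digit weight `p ^ x`. -/
def pval (p : ℕ) (M : Multiset ℕ) : ℕ := (M.map fun x => p ^ x).sum

/-- The size of a multiset of positions with respect to the rotation `j` of the types. -/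
def sz (p : ℕ) {f : ℕ} (ty : ℕ → ZMod f) (j : ZMod f) (M : Multiset ℕ) : ℕ :=
  (M.map fun x => p ^ (ty x + j).val).sum

/-- The number of positions of type `-j`. -/
def cnt {f : ℕ} (ty : ℕ → ZMod f) (j : ZMod f) (M : Multiset ℕ) : ℕ :=
  M.countP fun x => ty x = -j

/-! ### Sizes under rotation, their vectors, and splitting off a block. -/

section basic

variable {p f : ℕ} {ty : ℕ → ZMod f} {j : ZMod f} {M N : Multiset ℕ} {x : ℕ}

@[simp] theorem pval_zero : pval p 0 = 0 := by simp [pval]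

@[simp] theorem pval_add : pval p (M + N) = pval p M + pval p N := by simp [pval]

@[simp] theorem pval_singleton : pval p {x} = p ^ x := by simp [pval]

theorem pval_sum {ι : Type*} (s : Finset ι) (P : ι → Multiset ℕ) :
    pval p (∑ i ∈ s, P i) = ∑ i ∈ s, pval p (P i) := by
  classical
  induction s using Finset.induction_on with
  | empty => simp
  | insert a s ha ih => simp [Finset.sum_insert ha, ih]

theorem pval_mono (h : M ≤ N) : pval p M ≤ pval p N := by
  obtain ⟨K, rfl⟩ := Multiset.le_iff_exists_add.1 h
  simp

@[simp] theorem sz_zero : sz p ty j 0 = 0 := by simp [sz]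

@[simp] theorem sz_add : sz p ty j (M + N) = sz p ty j M + sz p ty j N := by simp [sz]

@[simp] theorem sz_singleton : sz p ty j {x} = p ^ (ty x + j).val := by simp [sz]

theorem sz_sum {ι : Type*} (s : Finset ι) (P : ι → Multiset ℕ) :
    sz p ty j (∑ i ∈ s, P i) = ∑ i ∈ s, sz p ty j (P i) := by
  classical
  induction s using Finset.induction_on with
  | empty => simp
  | insert a s ha ih => simp [Finset.sum_insert ha, ih]

theorem sz_mono (h : M ≤ N) : sz p ty j M ≤ sz p ty j N := by
  obtain ⟨K, rfl⟩ := Multiset.le_iff_exists_add.1 h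
  simp

theorem le_sz_of_mem (h : x ∈ M) : p ^ (ty x + j).val ≤ sz p ty j M := by
  rw [← sz_singleton (p := p) (ty := ty) (j := j)]
  exact sz_mono (Multiset.singleton_le.2 h)

@[simp] theorem cnt_zero : cnt ty j 0 = 0 := by simp [cnt]

@[simp] theorem cnt_add : cnt ty j (M + N) = cnt ty j M + cnt ty j N := by simp [cnt]

theorem cnt_mono (h : M ≤ N) : cnt ty j M ≤ cnt ty j N := Multiset.countP_le_of_le _ h

theorem val_add_one_eq [NeZero f] (v : ZMod f) :
    (v + 1).val = if v.val = f - 1 then 0 else v.val + 1 := by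
  have hf : f ≠ 0 := NeZero.ne f
  have hv := ZMod.val_lt v
  have h : (v + 1).val = (v.val + 1) % f := by
    rw [ZMod.val_add, ZMod.val_one_eq_one_mod, Nat.add_mod_mod]
  rw [h]
  split_ifs with h1
  · rw [h1, Nat.sub_add_cancel (by omega), Nat.mod_self]
  · exact Nat.mod_eq_of_lt (by omega)

/-- Rotating by one more step multiplies every weight by `p`, except that `p ^ (f - 1)` goes to `1`
instead of `p ^ f`. The count records these wrap-arounds. -/
theorem mul_sz [NeZero f] (hp : 0 < p) :
    p * sz p ty j M = sz p ty (j + 1) M + (p ^ f - 1) * cnt ty (j + 1) M := by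
  induction M using Multiset.induction_on with
  | empty => simp
  | cons a M ih =>
    rw [← Multiset.singleton_add, sz_add, cnt_add, sz_add, mul_add, mul_add, ih]
    have key : p * sz p ty j {a} = sz p ty (j + 1) {a} + (p ^ f - 1) * cnt ty (j + 1) {a} := by
      rw [sz_singleton, sz_singleton, ← add_assoc, val_add_one_eq]
      have hf : f ≠ 0 := NeZero.ne f
      have hlt := ZMod.val_lt (ty a + j)
      have hneg : ty a = -(j + 1) ↔ (ty a + j).val = f - 1 := by
        rw [eq_neg_iff_add_eq_zero, ← add_assoc, ← ZMod.val_eq_zero, val_add_one_eq]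
        split_ifs with h <;> simp [h]
      have hc : cnt ty (j + 1) {a} = if (ty a + j).val = f - 1 then 1 else 0 := by
        rw [cnt, ← Multiset.cons_zero, Multiset.countP_cons]
        simp only [Multiset.countP_zero, zero_add, hneg]
      rw [hc]
      split_ifs with h
      · rw [h, ← pow_succ', Nat.sub_add_cancel (by omega)]
        have : 0 < p ^ f := by positivity
        simp; omega
      · rw [pow_succ']; simp
    rw [key]; ring

theorem exists_le_cnt_eq [NeZero f] (n : ZMod f → ℕ) (h : ∀ j, n j ≤ cnt ty j M) :
    ∃ Y ≤ M, ∀ j, cnt ty j Y = n j := by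
  have hex : ∀ j, ∃ Y ≤ M.filter (fun x => ty x = -j), Y.card = n j := by
    intro j
    have : n j ≤ (M.filter fun x => ty x = -j).card := by
      rw [← Multiset.countP_eq_card_filter]; exact h j
    obtain ⟨Y, hY⟩ := Multiset.card_pos_iff_exists_mem.1
      (by rw [Multiset.card_powersetCard]; exact Nat.choose_pos this :
        0 < (Multiset.powersetCard (n j) (M.filter fun x => ty x = -j)).card)
    exact ⟨Y, Multiset.mem_powersetCard.1 hY⟩
  choose Y hY hc using hex
  have hmem : ∀ j, ∀ x ∈ Y j, ty x = -j := fun j x hx =>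
    (Multiset.mem_filter.1 (Multiset.mem_of_le (hY j) hx)).2
  have hcount : ∀ x, (∑ j, Y j).count x = (Y (-ty x)).count x := by
    intro x
    rw [Multiset.count_sum']
    refine Finset.sum_eq_single _ (fun j _ hj => ?_) (by simp)
    refine Multiset.count_eq_zero_of_notMem fun hx => hj ?_
    rw [hmem j x hx, neg_neg]
  refine ⟨∑ j, Y j, Multiset.le_iff_count.2 fun x => ?_, fun j => ?_⟩
  · rw [hcount]
    exact (Multiset.count_le_of_le x (hY _)).trans
      (Multiset.count_le_of_le x (Multiset.filter_le _ _))
  · have : (∑ i, Y i).filter (fun x => ty x = -j) = Y j := by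
      ext x
      by_cases hx : ty x = -j
      · rw [Multiset.count_filter_of_pos (p := fun x => ty x = -j) hx, hcount, hx, neg_neg]
      · rw [Multiset.count_filter_of_neg (p := fun x => ty x = -j) hx]
        exact (Multiset.count_eq_zero_of_notMem fun h => hx (hmem j x h)).symm
    rw [cnt, Multiset.countP_eq_card_filter, this, hc]

/-- The error `δ` between the two sides satisfies `p δ_j = δ_{j+1}`. Going once around the cycle
gives `(p ^ f - 1) δ = 0`. -/
theorem sz_eq_of_cnt [NeZero f] (hp : 2 ≤ p) (α : ZMod f → ℕ)
    (h : ∀ j, p * α j = α (j + 1) + cnt ty (j + 1) M) (j : ZMod f) :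
    sz p ty j M = (p ^ f - 1) * α j := by
  set δ : ZMod f → ℤ := fun j => (sz p ty j M : ℤ) - ((p ^ f - 1 : ℕ) : ℤ) * α j with hδ
  have hstep : ∀ j, p * δ j = δ (j + 1) := by
    intro j
    have h1 := mul_sz (p := p) (ty := ty) (j := j) (M := M) (by omega)
    have h2 := h j
    simp only [hδ]
    zify at h1 h2
    linear_combination h1 - ((p ^ f - 1 : ℕ) : ℤ) * h2
  have hit : ∀ n : ℕ, (p : ℤ) ^ n * δ j = δ (j + n) := by
    intro n
    induction n with
    | zero => simp
    | succ n ih => rw [pow_succ', mul_assoc, ih, hstep]; push_cast; rw [add_assoc]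
  have hfix := hit f
  rw [ZMod.natCast_self, add_zero] at hfix
  have hpf : (1 : ℤ) < (p : ℤ) ^ f := one_lt_pow₀ (by exact_mod_cast hp) (NeZero.ne f)
  have h0 : δ j = 0 := by
    have : ((p : ℤ) ^ f - 1) * δ j = 0 := by linear_combination hfix
    rcases mul_eq_zero.1 this with h | h
    · omega
    · exact h
  simp only [hδ] at h0
  zify
  linarith

/-- Lowering a vector as far as possible makes all of its counts at least those of `E`. -/
theorem exists_minimal_vector [NeZero f] (n e : ZMod f → ℕ) (hen : ∀ j, e j ≤ n j)
    (he : ∀ j, e j + 1 ≤ p) (y : ZMod f → ℕ) (hy : ∀ j, 1 ≤ y j)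
    (hyn : ∀ j, p * y j ≤ y (j + 1) + n (j + 1)) :
    ∃ α : ZMod f → ℕ, (∀ j, 1 ≤ α j ∧ α j ≤ y j) ∧
      ∀ j, p * α j ≤ α (j + 1) + n (j + 1) ∧ α (j + 1) + e (j + 1) ≤ p * α j := by
  induction hs : ∑ j, y j using Nat.strong_induction_on generalizing y with
  | _ s ih =>
    by_cases hall : ∀ j, y (j + 1) + e (j + 1) ≤ p * y j
    · exact ⟨y, fun j => ⟨hy j, le_rfl⟩, fun j => ⟨hyn j, hall j⟩⟩
    push Not at hall
    obtain ⟨i, hi⟩ := hall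
    -- The failing inequality gives `y (i + 1) > p * y i - e (i + 1) ≥ 1`, by `e j + 1 ≤ p`.
    have h2 : 2 ≤ y (i + 1) := by
      by_contra hlt
      have := hy i
      have := hy (i + 1)
      have := he (i + 1)
      have : p * 1 ≤ p * y i := Nat.mul_le_mul_left _ (hy i)
      omega
    -- As `e ≤ n`, the failing inequality leaves room to lower `y (i + 1)` by one in the upper bound
    -- at `i`. At all other places only left sides can shrink.
    set y' := Function.update y (i + 1) (y (i + 1) - 1) with hy'
    have hle : ∀ j, y' j ≤ y j := by
      intro j
      by_cases hj : j = i + 1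
      · subst hj; simp [hy']
      · simp [hy', hj]
    have hlt : ∑ j, y' j < s := by
      rw [← hs]
      refine Finset.sum_lt_sum (fun j _ => hle j) ⟨i + 1, Finset.mem_univ _, ?_⟩
      simp [hy']; omega
    have h1 : ∀ j, 1 ≤ y' j := by
      intro j
      by_cases hj : j = i + 1
      · subst hj; simp [hy']; omega
      · simp [hy', hj, hy j]
    have hn' : ∀ j, p * y' j ≤ y' (j + 1) + n (j + 1) := by
      intro j
      by_cases hj : j + 1 = i + 1
      · have hji : j = i := add_right_cancel hj
        subst hji
        have h3 := Nat.mul_le_mul_left p (hle j)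
        have h4 : y' (j + 1) = y (j + 1) - 1 := by simp [hy']
        have := hen (j + 1)
        omega
      · have h3 := Nat.mul_le_mul_left p (hle j)
        have h4 : y' (j + 1) = y (j + 1) := by simp [hy', hj]
        have := hyn j
        omega
    obtain ⟨α, hα, hα'⟩ := ih _ hlt y' h1 hn' rfl
    exact ⟨α, fun j => ⟨(hα j).1, (hα j).2.trans (hle j)⟩, hα'⟩

/-- The vector `α` prescribes how many positions of each type `Y` must have, and minimality makes
these numbers available in `X`. The bound `y` controls how much is left for the remaining blocks. -/
theorem exists_split [NeZero f] (hp : 2 ≤ p) (X E : Multiset ℕ) (hE : ∀ j, cnt ty j E + 1 ≤ p)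
    (y : ZMod f → ℕ) (hy : ∀ j, 1 ≤ y j)
    (hyn : ∀ j, p * y j ≤ y (j + 1) + (cnt ty (j + 1) X + cnt ty (j + 1) E)) :
    ∃ Y ≤ X, ∃ α : ZMod f → ℕ, ∀ j, 1 ≤ α j ∧ α j ≤ y j ∧
      sz p ty j (Y + E) = (p ^ f - 1) * α j := by
  obtain ⟨α, hα, hα'⟩ := exists_minimal_vector (p := p) (fun j => cnt ty j X + cnt ty j E)
    (fun j => cnt ty j E) (fun j => Nat.le_add_left _ _) hE y hy hyn
  obtain ⟨Y, hY, hc⟩ := exists_le_cnt_eq (ty := ty) (M := X)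
    (fun j => p * α (j - 1) - α j - cnt ty j E) (by
      intro j
      have := (hα' (j - 1)).1
      simp only [sub_add_cancel] at this
      omega)
  refine ⟨Y, hY, α, fun j => ⟨(hα j).1, (hα j).2, sz_eq_of_cnt hp α (fun j => ?_) j⟩⟩
  rw [cnt_add, hc, add_sub_cancel_right]
  have := (hα' j).2
  omega

end basic

/-- All sizes of `M` are positive multiples of `p ^ f - 1`. -/
def IsBlock (p : ℕ) {f : ℕ} (ty : ℕ → ZMod f) (M : Multiset ℕ) : Prop :=
  ∃ α : ZMod f → ℕ, ∀ j, 1 ≤ α j ∧ sz p ty j M = (p ^ f - 1) * α j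

/-! ### Rotations at which the low part `F` of the top class is small. -/

section exchange

variable {p f : ℕ} [NeZero f] {ty : ℕ → ZMod f}

theorem pow_val_le (hp : 2 ≤ p) (j : ZMod f) : p ^ j.val ≤ p ^ f - 1 := by
  have := Nat.pow_lt_pow_right (a := p) (by omega) (ZMod.val_lt j)
  omega

theorem val_sub_one {i : ZMod f} (hi : i ≠ 0) : (i - 1).val + 1 = i.val := by
  have h := val_add_one_eq (i - 1)
  rw [sub_add_cancel] at h
  have := mt (ZMod.val_eq_zero i).1 hi
  split_ifs at h <;> omega

theorem sz_lt_of_sub_one (hp : 2 ≤ p) {F : Multiset ℕ} {i : ZMod f} (hi : i ≠ 0)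
    (h : sz p ty (i - 1) F < p ^ (i - 1).val) : sz p ty i F < p ^ i.val := by
  have h1 := mul_sz (p := p) (ty := ty) (j := i - 1) (M := F) (by omega)
  rw [sub_add_cancel] at h1
  have h2 : p * sz p ty (i - 1) F < p * p ^ (i - 1).val :=
    Nat.mul_lt_mul_of_pos_left h (by omega)
  rw [← pow_succ', val_sub_one hi] at h2
  omega

theorem sz_lt_of_sz_zero_lt (hp : 2 ≤ p) {F : Multiset ℕ}
    (h : sz p ty 0 F < p ^ (0 : ZMod f).val) (i : ZMod f) : sz p ty i F < p ^ i.val := by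
  induction hn : i.val generalizing i with
  | zero =>
    rw [(ZMod.val_eq_zero i).1 hn]
    simpa using h
  | succ n ih =>
    have hi : i ≠ 0 := by rintro rfl; simp at hn
    have := val_sub_one hi
    rw [← hn]
    refine sz_lt_of_sub_one hp hi ?_
    have h1 : (i - 1).val = n := by omega
    rw [h1]
    exact ih _ h1

theorem val_lt_of_pow_lt (hp : 2 ≤ p) {i j : ZMod f} (h : p ^ j.val < p ^ (-i + j).val) :
    j.val < i.val := by
  have h1 := (Nat.pow_lt_pow_iff_right (a := p) (by omega)).1 h
  by_contra hlt
  rw [neg_add_eq_sub, ZMod.val_sub (by omega)] at h1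
  omega

/-- If `F` is small at `i`, then `F` cannot be at least `p ^ j` and smaller than an element of
type `-i` at `j`. -/
theorem not_between (hp : 2 ≤ p) {F : Multiset ℕ} {i j : ZMod f}
    (hi : sz p ty i F < p ^ i.val) (hj : p ^ j.val ≤ sz p ty j F)
    (hlt : sz p ty j F < p ^ (-i + j).val) : False := by
  have hji := val_lt_of_pow_lt hp (hj.trans_lt hlt)
  have hp1 : 1 < p := by omega
  have hvi := ZMod.val_lt i
  have hval : (-i + j).val + i.val = f + j.val := by
    have h0 : i ≠ 0 := by rintro rfl; simp at hji
    have hneg : (-i).val = f - i.val := by rw [ZMod.neg_val, if_neg h0]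
    rw [ZMod.val_add_of_lt (by omega), hneg]
    omega
  -- Both upper bounds force each position of `F` to wrap past `f` at both rotations, so its two
  -- weights differ exactly by the factor `p ^ (i - j)`.
  have hx : ∀ x ∈ F, p ^ (ty x + i).val = p ^ (i.val - j.val) * p ^ (ty x + j).val := by
    intro x hxF
    have h1 := (Nat.pow_lt_pow_iff_right hp1).1 ((le_sz_of_mem hxF).trans_lt hi)
    have h2 := (Nat.pow_lt_pow_iff_right hp1).1 ((le_sz_of_mem hxF).trans_lt hlt)
    have hxv := ZMod.val_lt (ty x)
    have h3 : f ≤ (ty x).val + i.val := by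
      by_contra hc
      rw [ZMod.val_add_of_lt (by omega)] at h1
      omega
    have h4 : f ≤ (ty x).val + j.val := by
      by_contra hc
      rw [ZMod.val_add_of_lt (by omega)] at h2
      omega
    rw [ZMod.val_add_of_le h3, ZMod.val_add_of_le h4, ← pow_add]
    congr 1
    omega
  have hsz : sz p ty i F = p ^ (i.val - j.val) * sz p ty j F := by
    rw [sz, sz, ← Multiset.sum_map_mul_left]
    exact congrArg Multiset.sum (Multiset.map_congr rfl hx)
  have : p ^ i.val ≤ sz p ty i F := by
    rw [hsz]
    calc p ^ i.val = p ^ (i.val - j.val) * p ^ j.val := by rw [← pow_add]; congr 1; omega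
      _ ≤ _ := Nat.mul_le_mul_left _ hj
  omega

/-- Without `e` there is still at least one unit `p ^ f - 1` at every rotation: where `F` is not
small it makes up for the weight `p ^ j` of `e`, and elsewhere `ρ j ≥ 2`. -/
theorem bubble_zero (hp : 2 ≤ p) {e : ℕ} (he : ty e = 0) {E R F : Multiset ℕ}
    {ρ : ZMod f → ℕ} (hE : ∀ j, cnt ty j E + 1 ≤ p)
    (hρ : ∀ j, 1 ≤ ρ j ∧ sz p ty j (R + E) = (p ^ f - 1) * ρ j)
    (hJ : ∀ j, sz p ty j F < p ^ j.val → 2 ≤ ρ j) (heR : e ∈ R) :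
    ∃ Y F' : Multiset ℕ, Y + F' = R + F ∧ IsBlock p ty (Y + E) ∧ e ∈ F' := by
  obtain ⟨R, rfl⟩ := Multiset.exists_cons_of_mem heR
  set Q := p ^ f - 1 with hQ
  have hQ1 : 1 ≤ Q := by
    have := pow_val_le (f := f) hp 0
    simpa using this
  have hbig : ∀ j, Q ≤ sz p ty j (R + F + E) := by
    intro j
    have h1 := (hρ j).2
    rw [← Multiset.singleton_add] at h1
    simp only [sz_add, sz_singleton, he, zero_add] at h1 ⊢
    have h2 := pow_val_le hp j
    by_cases hj : sz p ty j F < p ^ j.val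
    · have h3 := Nat.mul_le_mul_left Q (hJ j hj)
      omega
    · have h3 := Nat.mul_le_mul_left Q (hρ j).1
      omega
  -- Rounded-down quotients are admissible bounds: `p ⌊s_j / Q⌋ ≤ ⌊p s_j / Q⌋ = ⌊s_{j+1} / Q⌋ +
  -- cnt_{j+1}`, by `mul_sz`.
  obtain ⟨Y, hY, α, hα⟩ := exists_split (ty := ty) hp (R + F) E hE
    (fun j => sz p ty j (R + F + E) / Q) (fun j => (Nat.one_le_div_iff (by omega)).2 (hbig j))
    (fun j => by
      have h := mul_sz (p := p) (ty := ty) (j := j) (M := R + F + E) (by omega)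
      rw [← hQ] at h
      rw [← cnt_add, ← Nat.add_mul_div_left _ _ (by omega : 0 < Q), ← h]
      exact Nat.mul_div_le_mul_div_assoc _ _ _)
  obtain ⟨Z, hZ⟩ := Multiset.le_iff_exists_add.1 hY
  refine ⟨Y, e ::ₘ Z, ?_, ⟨α, fun j => ⟨(hα j).1, (hα j).2.2⟩⟩, Multiset.mem_cons_self _ _⟩
  rw [Multiset.add_cons, Multiset.cons_add, ← hZ]

/-- The part of `R + M` that must not move down: the elements of `M` above `e`, and all `e`. -/
def protect (e : ℕ) (R M : Multiset ℕ) : Multiset ℕ :=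
  M.filter (fun x => e < x) + (R + M).filter (fun x => x = e)

theorem protect_le (e : ℕ) (R M : Multiset ℕ) : protect e R M ≤ R + M := by
  refine Multiset.le_iff_count.2 fun x => ?_
  simp only [protect, Multiset.count_add, Multiset.count_filter]
  split_ifs <;> omega

theorem filter_le_protect (e : ℕ) (R M : Multiset ℕ) :
    M.filter (fun x => ¬ x < e) ≤ protect e R M := by
  refine Multiset.le_iff_count.2 fun x => ?_
  simp only [protect, Multiset.count_add, Multiset.count_filter]
  split_ifs <;> omega

end exchange

/-! ### Type counts of the protected positions. -/

section protect

variable {f : ℕ} {ty : ℕ → ZMod f}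

theorem cnt_protect_zero {e : ℕ} (he : ty e = 0) {R M : Multiset ℕ}
    (h : ∀ x ∈ M, e < x → ty x ≠ 0) : cnt ty 0 (protect e R M) = (R + M).count e := by
  have h1 : cnt ty 0 (M.filter fun x => e < x) = 0 := by
    rw [cnt, Multiset.countP_eq_zero]
    intro x hx
    rw [Multiset.mem_filter] at hx
    simpa using h x hx.1 hx.2
  have h2 : (R + M).filter (fun x => x = e) = Multiset.replicate ((R + M).count e) e :=
    Multiset.filter_eq' _ _
  rw [protect, cnt_add, h1, zero_add, h2, cnt, Multiset.countP_eq_card_filter,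
    Multiset.filter_eq_self.2, Multiset.card_replicate]
  intro x hx
  rw [Multiset.eq_of_mem_replicate hx, he, neg_zero]

theorem cnt_protect_of_ne {e : ℕ} (he : ty e = 0) {R M : Multiset ℕ} {i : ZMod f} (hi : i ≠ 0) :
    cnt ty i (protect e R M) = cnt ty i (M.filter fun x => e < x) := by
  have h2 : (R + M).filter (fun x => x = e) = Multiset.replicate ((R + M).count e) e :=
    Multiset.filter_eq' _ _
  rw [protect, cnt_add, h2, Nat.add_eq_left, cnt, Multiset.countP_eq_zero]
  intro x hx
  rw [Multiset.eq_of_mem_replicate hx, he]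
  exact fun h => hi (neg_eq_zero.1 h.symm)

end protect

/-! ### The vector reserved for the remainder. -/

section exchange

variable {p f : ℕ} [NeZero f] {ty : ℕ → ZMod f}

open Classical in
/-- The lower bound for the vector of the remainder in one step of the exchange. -/
noncomputable def stepBound (J T L : ZMod f → Prop) (a : ZMod f → ℕ) (i : ZMod f) : ℕ :=
  if J i then (if L i then 1 else 2)
  else if ∃ j, j.val ≤ i.val ∧ ¬ J j ∧ T j then a i else 1

/-- This is the inequality needed to apply `exists_split` to the unprotected positions. For `i ≠ 0`,
`not_between` excludes protected positions of type `-i` where `F` is small. Where they do occur, the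
bound is `a` at `i - 1` and `i`, and the recursion for `a` accounts for them. In type `0` only
copies of `e` are protected. -/
theorem stepBound_spec (hp : 2 ≤ p) {e : ℕ} (he : ty e = 0) {F R M : Multiset ℕ}
    {T L : ZMod f → Prop} {a : ZMod f → ℕ} (ha : ∀ j, 1 ≤ a j)
    (hM : ∀ j, sz p ty j M = (p ^ f - 1) * a j) (hT : ∀ j, T j → a j = 1)
    (hz : ∀ z ∈ M, e < z → ∃ j, p ^ j.val ≤ sz p ty j F ∧ T j ∧
      sz p ty j F < p ^ (ty z + j).val)
    (hc : (R + M).count e + 1 ≤ p)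
    (h0 : sz p ty 0 F < p ^ (0 : ZMod f).val → (∀ j, ¬ L j) ∨ (R + M).count e + 2 ≤ p)
    (i : ZMod f) :
    stepBound (fun j => sz p ty j F < p ^ j.val) T L a i + cnt ty i (protect e R M) ≤
      p * stepBound (fun j => sz p ty j F < p ^ j.val) T L a (i - 1) := by
  set J : ZMod f → Prop := fun j => sz p ty j F < p ^ j.val with hJ
  have hr1 : ∀ j, 1 ≤ stepBound J T L a j := by
    intro j
    unfold stepBound
    split_ifs <;> first | exact ha j | norm_num
  have hp1 : ∀ j, p ≤ p * stepBound J T L a j := fun j => Nat.le_mul_of_pos_right p (hr1 j)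
  by_cases hi : i = 0
  · subst hi
    rw [cnt_protect_zero he]
    -- The critical case: the bound may be `2` at `0` and only `1` at `0 - 1`. Then `p - 1` copies
    -- of `e` would be too many, unless the bound is constantly `2`.
    · by_cases hJ0 : J 0
      · have hall : ∀ j, J j := fun j => sz_lt_of_sz_zero_lt hp hJ0 j
        rcases h0 hJ0 with hL | h2
        · have h2 : ∀ j, stepBound J T L a j = 2 := fun j => by
            rw [stepBound, if_pos (hall j), if_neg (hL j)]
          rw [h2, h2]
          omega
        · have h3 : stepBound J T L a 0 ≤ 2 := by
            rw [stepBound, if_pos hJ0]; split_ifs <;> norm_num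
          have := hp1 (0 - 1)
          omega
      · have h3 : stepBound J T L a 0 = 1 := by
          rw [stepBound, if_neg hJ0]
          split_ifs with h
          · obtain ⟨j, hj, -, hTj⟩ := h
            have : j = 0 := (ZMod.val_eq_zero j).1 (by simpa using hj)
            exact hT 0 (this ▸ hTj)
          · rfl
        have := hp1 (0 - 1)
        omega
    · intro x hx hex hx0
      obtain ⟨j, h1, -, h2⟩ := hz x hx hex
      rw [hx0, zero_add] at h2
      omega
  · rw [cnt_protect_of_ne he hi]
    have hmem : cnt ty i (M.filter fun x => e < x) ≠ 0 → ∃ j, p ^ j.val ≤ sz p ty j F ∧ T j ∧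
        sz p ty j F < p ^ (-i + j).val := by
      intro h
      obtain ⟨x, hx, hxi⟩ := Multiset.countP_pos.1 (Nat.pos_of_ne_zero h)
      rw [Multiset.mem_filter] at hx
      rw [← hxi]
      exact hz x hx.1 hx.2
    by_cases hJi : J i
    · have h3 : stepBound J T L a i ≤ 2 := by
        rw [stepBound, if_pos hJi]; split_ifs <;> norm_num
      have h4 : cnt ty i (M.filter fun x => e < x) = 0 := by
        by_contra h
        obtain ⟨j, h1, -, h2⟩ := hmem h
        exact not_between hp hJi h1 h2
      have := hp1 (i - 1)
      omega
    · have hJi' : ¬ J (i - 1) := fun h => hJi (sz_lt_of_sub_one hp hi h)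
      have hval := val_sub_one hi
      by_cases ht : ∃ j : ZMod f, j.val ≤ (i - 1).val ∧ ¬ J j ∧ T j
      · have ht' : ∃ j : ZMod f, j.val ≤ i.val ∧ ¬ J j ∧ T j := by
          obtain ⟨j, hj, h⟩ := ht
          exact ⟨j, by omega, h⟩
        rw [stepBound, stepBound, if_neg hJi, if_neg hJi', if_pos ht, if_pos ht']
        have h1 := mul_sz (p := p) (ty := ty) (j := i - 1) (M := M) (by omega)
        rw [sub_add_cancel, hM, hM] at h1
        have hQ1 : 0 < p ^ f - 1 := by
          have := pow_val_le (f := f) hp 0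
          simp at this; omega
        have h2 : p * a (i - 1) = a i + cnt ty i M :=
          Nat.eq_of_mul_eq_mul_left hQ1 (by rw [mul_add, ← h1]; ring)
        rw [h2]
        exact Nat.add_le_add_left (cnt_mono (Multiset.filter_le _ _)) _
      · have h4 : cnt ty i (M.filter fun x => e < x) = 0 := by
          by_contra h
          obtain ⟨j, h1, hTj, h2⟩ := hmem h
          have := val_lt_of_pow_lt hp (h1.trans_lt h2)
          exact ht ⟨j, by omega, by simp only [hJ]; omega, hTj⟩
        have h3 : stepBound J T L a i = 1 := by
          rw [stepBound, if_neg hJi]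
          split_ifs with h
          · obtain ⟨j, hj, hJj, hTj⟩ := h
            have : j = i := by
              by_contra hne
              have : j.val ≠ i.val := fun h => hne (ZMod.val_injective f h)
              exact ht ⟨j, by omega, hJj, hTj⟩
            exact hT i (this ▸ hTj)
          · rfl
        have := hp1 (i - 1)
        omega

end exchange

/-! ### Carrying a position up through the classes. -/

section exchange

variable {p f : ℕ} [NeZero f] {ty : ℕ → ZMod f}

theorem pval_filter_add (e : ℕ) (M : Multiset ℕ) :
    pval p (M.filter (· < e)) + pval p (M.filter fun x => ¬ x < e) = pval p M := by
  rw [← pval_add, Multiset.filter_add_not]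

/-- One step of the exchange: `R + M` is split again into a block `Y + E` and a remainder `w`
containing the protected elements. -/
theorem exists_step (hp : 2 ≤ p) {e : ℕ} (he : ty e = 0) {E R F M : Multiset ℕ}
    {ρ a : ZMod f → ℕ} {T L : ZMod f → Prop} (hE : ∀ j, cnt ty j E + 1 ≤ p)
    (hρ : ∀ j, 1 ≤ ρ j ∧ sz p ty j (R + E) = (p ^ f - 1) * ρ j)
    (ha : ∀ j, 1 ≤ a j ∧ sz p ty j M = (p ^ f - 1) * a j)
    (hJ : ∀ j, sz p ty j F < p ^ j.val → 2 ≤ ρ j ∨ 2 ≤ a j ∨ L j)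
    (hT : ∀ j, T j → a j = 1)
    (hz : ∀ z ∈ M, e < z → ∃ j, p ^ j.val ≤ sz p ty j F ∧ T j ∧
      sz p ty j F < p ^ (ty z + j).val)
    (hc : (R + M).count e + 1 ≤ p)
    (h0 : sz p ty 0 F < p ^ (0 : ZMod f).val → (∀ j, ¬ L j) ∨ (R + M).count e + 2 ≤ p) :
    ∃ Y w : Multiset ℕ, Y + w = R + M ∧ protect e R M ≤ w ∧ IsBlock p ty (Y + E) ∧
      ∃ σ : ZMod f → ℕ, (∀ j, 1 ≤ σ j ∧ sz p ty j w = (p ^ f - 1) * σ j) ∧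
        ∀ j, sz p ty j F < p ^ j.val → 2 ≤ σ j ∨ L j := by
  classical
  set r := stepBound (fun j => sz p ty j F < p ^ j.val) T L a with hr
  have hspec := stepBound_spec hp he (fun j => (ha j).1) (fun j => (ha j).2) hT hz hc h0
  rw [← hr] at hspec
  obtain ⟨X, hX⟩ := Multiset.le_iff_exists_add.1 (protect_le e R M)
  have hr1 : ∀ j, 1 ≤ r j := by
    intro j
    rw [hr]
    unfold stepBound
    split_ifs <;> first | exact (ha j).1 | norm_num
  have hru : ∀ j, r j + 1 ≤ ρ j + a j := by
    intro j
    have h1 := (hρ j).1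
    have h2 := (ha j).1
    rw [hr]
    unfold stepBound
    split_ifs with h3 h4 <;> try omega
    rcases hJ j h3 with h | h | h
    · omega
    · omega
    · exact absurd h h4
  -- Together the two blocks have vector `ρ + a`. Capping the new block at `ρ + a - r` leaves a
  -- remainder with vector at least `r`.
  obtain ⟨Y, hY, α, hα⟩ := exists_split (ty := ty) hp X E hE (fun j => ρ j + a j - r j)
    (fun j => by have := hru j; omega) (fun j => by
      have hu : p * (ρ j + a j) = ρ (j + 1) + a (j + 1) + cnt ty (j + 1) (R + M) +
          cnt ty (j + 1) E := by
        have h1 := mul_sz (p := p) (ty := ty) (j := j) (M := R + E) (by omega)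
        have h2 := mul_sz (p := p) (ty := ty) (j := j) (M := M) (by omega)
        rw [(hρ j).2, (hρ (j + 1)).2] at h1
        rw [(ha j).2, (ha (j + 1)).2] at h2
        have hQ1 : 0 < p ^ f - 1 := by
          have := pow_val_le (f := f) hp 0
          simp at this; omega
        refine Nat.eq_of_mul_eq_mul_left hQ1 ?_
        simp only [cnt_add] at h1 ⊢
        linear_combination h1 + h2
      have h3 := hspec (j + 1)
      rw [add_sub_cancel_right] at h3
      rw [hX, cnt_add] at hu
      have h4 := hru (j + 1)
      rw [Nat.mul_sub]
      omega)
  obtain ⟨Z, rfl⟩ := Multiset.le_iff_exists_add.1 hY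
  have hYw : Y + (protect e R M + Z) = R + M := by rw [hX]; abel
  refine ⟨Y, protect e R M + Z, hYw, Multiset.le_add_right _ _,
    ⟨α, fun j => ⟨(hα j).1, (hα j).2.2⟩⟩, fun j => ρ j + a j - α j, fun j => ⟨?_, ?_⟩, ?_⟩
  · have h1 : α j ≤ ρ j + a j - r j := (hα j).2.1
    have h2 := hr1 j
    have h3 := hru j
    show 1 ≤ ρ j + a j - α j
    omega
  · have h1 := congrArg (sz p ty j) hYw
    have h2 := (hα j).2.2
    have h3 := (hρ j).2
    have h4 := (ha j).2
    simp only [sz_add] at h1 h2 h3 ⊢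
    rw [Nat.mul_sub, mul_add]
    omega
  · intro j hj
    by_cases hL : L j
    · exact Or.inr hL
    · have h2 : r j = 2 := by rw [hr, stepBound, if_pos hj, if_neg hL]
      have h1 : α j ≤ ρ j + a j - r j := (hα j).2.1
      have h3 := hru j
      left
      show 2 ≤ ρ j + a j - α j
      omega

/-- Here `R` is class `0`, `P i` is class `i + 1`, and `F` is part of class `m + 1`. Each step
leaves a block behind and passes the remainder up as the next `R`, with `E = 0` from then on.
Positions of `P i` from `e` upward are protected, so only those below `e` can drop, by one class,
and a copy of `e` reaches `F'`. This is the weight inequality at the end. The last hypothesis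
concerns only empty `F`: a copy of `e` waiting in the last class keeps the earlier counts below `p -
1`. -/
theorem bubble (hp : 2 ≤ p) {e : ℕ} (he : ty e = 0) {F : Multiset ℕ} (hF : ∀ x ∈ F, x < e)
    (m : ℕ) : ∀ (E R : Multiset ℕ) (P : ℕ → Multiset ℕ) (ρ : ZMod f → ℕ) (a : ℕ → ZMod f → ℕ),
    (∀ j, cnt ty j E + 1 ≤ p) →
    (∀ j, 1 ≤ ρ j ∧ sz p ty j (R + E) = (p ^ f - 1) * ρ j) →
    (∀ i < m, ∀ j, 1 ≤ a i j ∧ sz p ty j (P i) = (p ^ f - 1) * a i j) →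
    (∀ j, sz p ty j F < p ^ j.val → 2 ≤ ρ j ∨ ∃ i < m, 2 ≤ a i j) →
    (∀ i < m, ∀ z ∈ P i, e < z → ∃ j, p ^ j.val ≤ sz p ty j F ∧ (∀ i < m, a i j = 1) ∧
      sz p ty j F < p ^ (ty z + j).val) →
    (e ∈ R ∨ ∃ i < m, e ∈ P i) →
    (R + ∑ i ∈ Finset.range m, P i).count e + 1 ≤ p →
    (sz p ty 0 F < p ^ (0 : ZMod f).val → m = 0 ∨ e ∈ P (m - 1)) →
    ∃ (P' : ℕ → Multiset ℕ) (F' : Multiset ℕ),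
      ∑ i ∈ Finset.range (m + 1), P' i + F' = R + ∑ i ∈ Finset.range m, P i + F ∧
      IsBlock p ty (P' 0 + E) ∧ (∀ i, 1 ≤ i → i ≤ m → IsBlock p ty (P' i)) ∧
      ∑ i ∈ Finset.range m, (i + 1) * pval p (P i) + (m + 1) * pval p F + p ^ e ≤
        ∑ i ∈ Finset.range (m + 1), i * pval p (P' i) + (m + 1) * pval p F' +
          pval p ((∑ i ∈ Finset.range m, P i + F).filter (· < e)) := by
  induction m with
  | zero =>
    intro E R P ρ a hE hρ _ hJ _ heR _ _
    simp only [Nat.not_lt_zero, false_and, exists_false, or_false] at hJ heR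
    obtain ⟨Y, F', h1, h2, h3⟩ := bubble_zero hp he hE hρ hJ heR
    refine ⟨fun _ => Y, F', by simpa using h1, h2, fun i hi hi' => by omega, ?_⟩
    have h4 : F.filter (· < e) = F := Multiset.filter_eq_self.2 hF
    have h5 : p ^ e ≤ pval p F' := by
      rw [← pval_singleton (p := p)]
      exact pval_mono (Multiset.singleton_le.2 h3)
    simp [h4]
    omega
  | succ m ih =>
    intro E R P ρ a hE hρ ha hJ hz heR hc h0
    rw [Finset.sum_range_succ'] at hc
    have hc' : (R + P 0).count e + (∑ i ∈ Finset.range m, P (i + 1)).count e + 1 ≤ p := by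
      rw [← Multiset.count_add]
      convert hc using 3
      abel
    obtain ⟨Y, w, hYw, hprot, hblock, σ, hσ, hσJ⟩ := exists_step
      (L := fun j => ∃ i < m, 2 ≤ a (i + 1) j) (T := fun j => ∀ i < m + 1, a i j = 1)
      hp he hE hρ (ha 0 (by omega)) (F := F)
      (fun j hj => by
        rcases hJ j hj with h | ⟨i, hi, h⟩
        · exact Or.inl h
        · cases i with
          | zero => exact Or.inr (Or.inl h)
          | succ i => exact Or.inr (Or.inr ⟨i, by omega, h⟩))
      (fun j h => h 0 (by omega)) (hz 0 (by omega)) (by omega) (fun hj => by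
        cases m with
        | zero => left; simp
        | succ m =>
          right
          have h1 : e ∈ P (m + 1) := by simpa using h0 hj
          have h2 : e ∈ ∑ i ∈ Finset.range (m + 1), P (i + 1) :=
            Multiset.mem_sum.2 ⟨m, by simp, h1⟩
          have := Multiset.count_pos.2 h2
          omega)
    have hwe : e ∈ w ∨ ∃ i < m, e ∈ P (i + 1) := by
      have : e ∈ R + P 0 → e ∈ w := fun h => Multiset.mem_of_le hprot <|
        Multiset.mem_add.2 (Or.inr (Multiset.mem_filter.2 ⟨h, rfl⟩))
      rcases heR with h | ⟨i, hi, h⟩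
      · exact Or.inl (this (Multiset.mem_add.2 (Or.inl h)))
      · cases i with
        | zero => exact Or.inl (this (Multiset.mem_add.2 (Or.inr h)))
        | succ i => exact Or.inr ⟨i, by omega, h⟩
    obtain ⟨P', F', hsum, hP0, hPi, hW⟩ := ih 0 w (fun i => P (i + 1)) σ (fun i => a (i + 1))
      (fun j => by simpa using (by omega : 1 ≤ p)) (by simpa using hσ)
      (fun i hi => ha (i + 1) (by omega)) hσJ
      (fun i hi z hzi hez => by
        obtain ⟨j, h1, h2, h3⟩ := hz (i + 1) (by omega) z hzi hez
        exact ⟨j, h1, fun i hi => h2 (i + 1) (by omega), h3⟩)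
      hwe
      (by
        have h1 : w.count e ≤ (R + P 0).count e := by
          rw [← hYw]; exact Multiset.count_le_of_le _ (Multiset.le_add_left _ _)
        rw [Multiset.count_add]
        omega)
      (fun hj => by
        cases m with
        | zero => exact Or.inl rfl
        | succ m => right; simpa using h0 hj)
    rw [add_zero] at hP0
    refine ⟨fun i => Nat.casesOn i Y P', F', ?_, hblock, ?_, ?_⟩
    · rw [Finset.sum_range_succ', Finset.sum_range_succ' P]
      change ∑ i ∈ Finset.range (m + 1), P' i + Y + F' = _
      calc _ = Y + (∑ i ∈ Finset.range (m + 1), P' i + F') := by abel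
        _ = (Y + w) + ∑ i ∈ Finset.range m, P (i + 1) + F := by rw [hsum]; abel
        _ = _ := by rw [hYw]; abel
    · intro i hi him
      cases i with
      | zero => omega
      | succ i =>
        cases i with
        | zero => exact hP0
        | succ i => exact hPi (i + 1) (by omega) (by omega)
    · have hv := congrArg (pval p) hsum
      have hlow : pval p (P 0) ≤ pval p ((P 0).filter (· < e)) + pval p w := by
        rw [← pval_filter_add e (P 0)]
        exact Nat.add_le_add_left (pval_mono ((filter_le_protect e R (P 0)).trans hprot)) _
      rw [Finset.sum_range_succ', Finset.sum_range_succ' (fun i => i * _),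
        Finset.sum_range_succ' P]
      simp only [pval_add, pval_sum, Multiset.filter_add, add_mul, one_mul, zero_mul, zero_add,
        Finset.sum_add_distrib] at hv hW ⊢
      omega

end exchange

/-! ### Blocks as divisibility by `p ^ f - 1`, and valid divisions. -/

section partition

variable {p f : ℕ}

theorem pval_filter_lt {M : Multiset ℕ} (hM : ∀ x, M.count x + 1 ≤ p) (e : ℕ) :
    pval p (M.filter (· < e)) < p ^ e := by
  induction e with
  | zero => simp
  | succ e ih =>
    have h : M.filter (· < e + 1) = M.filter (· < e) + Multiset.replicate (M.count e) e := by
      rw [← Multiset.filter_eq' M e]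
      ext x
      simp only [Multiset.count_add, Multiset.count_filter]
      split_ifs <;> omega
    have h2 : pval p (Multiset.replicate (M.count e) e) = M.count e * p ^ e := by
      simp [pval]
    rw [h, pval_add, h2]
    have h3 := Nat.mul_le_mul_right (p ^ e) (hM e)
    rw [pow_succ', add_mul] at *
    omega

theorem pow_le_pval {M : Multiset ℕ} {x : ℕ} (h : x ∈ M) : p ^ x ≤ pval p M := by
  rw [← pval_singleton (p := p)]
  exact pval_mono (Multiset.singleton_le.2 h)

/-- The type function giving the class of a position modulo `f`, relative to `c`. -/
def relType (f : ℕ) (c : ZMod f) (x : ℕ) : ZMod f := x - c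

theorem sz_relType (c j : ZMod f) (M : Multiset ℕ) :
    sz p (relType f c) j M = sz p (relType f 0) (j - c) M := by
  simp only [sz, relType]
  congr 2
  ext x
  congr 2
  ring

theorem cnt_relType (c j : ZMod f) (M : Multiset ℕ) :
    cnt (relType f c) j M = M.countP fun x : ℕ => (x : ZMod f) = c - j := by
  simp only [cnt, relType, sub_eq_iff_eq_add, neg_add_eq_sub]

/-- `M` is nonempty and its value is divisible by `p ^ f - 1`. -/
def DivBlock (p f : ℕ) (M : Multiset ℕ) : Prop := (p ^ f - 1) ∣ pval p M ∧ M ≠ 0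

theorem pow_modEq [NeZero f] (hp : 2 ≤ p) {a b : ℕ} (h : (a : ZMod f) = b) :
    p ^ a ≡ p ^ b [MOD p ^ f - 1] := by
  have h1 : p ^ f ≡ 1 [MOD p ^ f - 1] := by
    have h0 : 1 ≤ p ^ f := Nat.one_le_pow _ _ (by omega)
    exact ((Nat.modEq_iff_dvd' h0).2 dvd_rfl).symm
  have key : ∀ a : ℕ, p ^ a ≡ p ^ (a % f) [MOD p ^ f - 1] := by
    intro a
    conv_lhs => rw [← Nat.div_add_mod a f, pow_add, pow_mul]
    simpa using (h1.pow (a / f)).mul_right (p ^ (a % f))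
  have h2 : a % f = b % f := (ZMod.natCast_eq_natCast_iff' a b f).1 h
  exact (key a).trans (h2 ▸ (key b).symm)

/-- The exponents `(c - j) + (x - c + j)` and `x` agree mod `f`, and `p ^ f ≡ 1`. -/
theorem pow_mul_sz_modEq [NeZero f] (hp : 2 ≤ p) (c j : ZMod f) (M : Multiset ℕ) :
    p ^ (c - j).val * sz p (relType f c) j M ≡ pval p M [MOD p ^ f - 1] := by
  induction M using Multiset.induction_on with
  | empty => rfl
  | cons a M ih =>
    rw [← Multiset.singleton_add, sz_add, pval_add, mul_add, sz_singleton, pval_singleton,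
      ← pow_add]
    refine Nat.ModEq.add (pow_modEq hp ?_) ih
    push_cast
    rw [ZMod.natCast_zmod_val, ZMod.natCast_zmod_val, relType]
    ring

/-- As `p` is prime to `p ^ f - 1`, one size is divisible iff all are, whatever the base point `c`.
This allows types to be taken relative to any position `e`. -/
theorem isBlock_iff [NeZero f] (hp : 2 ≤ p) (c : ZMod f) (M : Multiset ℕ) :
    IsBlock p (relType f c) M ↔ DivBlock p f M := by
  have hQ1 : 1 ≤ p ^ f - 1 := by
    simpa using pow_val_le (f := f) hp 0
  have hcop : ∀ n, Nat.Coprime (p ^ f - 1) (p ^ n) := by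
    intro n
    refine Nat.Coprime.pow_right n ?_
    have h1 : Nat.Coprime (p ^ f - 1) (p ^ f) := by
      have h0 : 1 ≤ p ^ f := by omega
      conv_rhs => rw [← Nat.sub_add_cancel h0]
      simp
    exact Nat.Coprime.coprime_dvd_right (dvd_pow_self p (NeZero.ne f)) h1
  have hdvd : ∀ j, (p ^ f - 1) ∣ sz p (relType f c) j M ↔ (p ^ f - 1) ∣ pval p M := by
    intro j
    rw [← (pow_mul_sz_modEq hp c j M).dvd_iff dvd_rfl, (hcop _).dvd_mul_left]
  constructor
  · rintro ⟨α, hα⟩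
    refine ⟨(hdvd 0).1 ((hα 0).2 ▸ dvd_mul_right _ _), ?_⟩
    rintro rfl
    have h1 := (hα 0).1
    have h2 := (hα 0).2
    rw [sz_zero] at h2
    rcases mul_eq_zero.1 h2.symm with h | h <;> omega
  · rintro ⟨h, hM⟩
    choose α hα using fun j => (hdvd j).2 h
    refine ⟨α, fun j => ⟨?_, hα j⟩⟩
    obtain ⟨x, hx⟩ := Multiset.exists_mem_of_ne_zero hM
    have h1 := le_sz_of_mem (p := p) (ty := relType f c) (j := j) hx
    have h2 : 0 < p ^ (relType f c x + j).val := by positivity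
    rw [hα] at h1
    exact Nat.pos_of_ne_zero fun h0 => by simp [h0] at h1; omega

/-- Numerical criterion for the existence of `d` disjoint blocks, the first one containing `E`. -/
theorem exists_partition [NeZero f] (hp : 2 ≤ p) (d : ℕ) : ∀ (E X : Multiset ℕ),
    (∀ j, cnt (relType f 0) j E + 1 ≤ p) →
    (∀ j, d * (p ^ f - 1) ≤ sz p (relType f 0) j X + sz p (relType f 0) j E) →
    ∃ P : ℕ → Multiset ℕ, ∑ i ∈ Finset.range (d + 1), P i = X ∧
      ∀ i < d, DivBlock p f (P i + if i = 0 then E else 0) := by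
  have hQ1 : 1 ≤ p ^ f - 1 := by
    simpa using pow_val_le (f := f) hp 0
  induction d with
  | zero => exact fun E X _ _ => ⟨fun _ => X, by simp⟩
  | succ d ih =>
    intro E X hE hX
    have hdiv : ∀ j, d + 1 ≤ (sz p (relType f 0) j (X + E)) / (p ^ f - 1) := fun j => by
      rw [Nat.le_div_iff_mul_le (by omega), sz_add]; exact hX j
    -- Subtracting `d` reserves one unit at each rotation for every block still to be formed.
    obtain ⟨Y, hY, α, hα⟩ := exists_split (ty := relType f 0) hp X E hE
      (fun j => sz p (relType f 0) j (X + E) / (p ^ f - 1) - d)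
      (fun j => by have := hdiv j; omega)
      (fun j => by
        have h := mul_sz (p := p) (ty := relType f 0) (j := j) (M := X + E) (by omega)
        have h1 : p * (sz p (relType f 0) j (X + E) / (p ^ f - 1)) ≤
            sz p (relType f 0) (j + 1) (X + E) / (p ^ f - 1) +
              (cnt (relType f 0) (j + 1) X + cnt (relType f 0) (j + 1) E) := by
          rw [← cnt_add, ← Nat.add_mul_div_left _ _ (by omega : 0 < p ^ f - 1), ← h]
          exact Nat.mul_div_le_mul_div_assoc _ _ _
        have h2 := hdiv (j + 1)
        have h3 : 1 * d ≤ p * d := Nat.mul_le_mul_right _ (by omega)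
        rw [Nat.mul_sub]
        omega)
    obtain ⟨Z, rfl⟩ := Multiset.le_iff_exists_add.1 hY
    obtain ⟨P, hP, hPb⟩ := ih 0 Z (fun j => by simpa using (by omega : 1 ≤ p)) (fun j => by
      obtain ⟨h1, h2, h3⟩ := hα j
      have h4 := Nat.mul_le_mul_left (p ^ f - 1) h2
      have h5 := Nat.mul_div_le (sz p (relType f 0) j (Y + Z + E)) (p ^ f - 1)
      have h6 := Nat.mul_le_mul_left (p ^ f - 1) (hdiv j)
      rw [Nat.mul_sub] at h4
      simp only [sz_add, sz_zero, mul_add, mul_one] at h3 h4 h5 h6 ⊢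
      rw [mul_comm d]
      omega)
    refine ⟨fun i => Nat.casesOn i Y P, ?_, ?_⟩
    · rw [Finset.sum_range_succ']
      change ∑ i ∈ Finset.range (d + 1), P i + Y = _
      rw [hP, add_comm]
    · intro i hi
      cases i with
      | zero => exact (isBlock_iff hp 0 _).1 ⟨α, fun j => ⟨(hα j).1, (hα j).2.2⟩⟩
      | succ i => simpa using hPb i (by omega)

/-- A division of the positions in `D` into classes `P 0, …, P d` such that `P 0 + E` and
`P 1, …, P (d - 1)` are blocks. -/
def Valid (p f : ℕ) (E D : Multiset ℕ) (d : ℕ) (P : ℕ → Multiset ℕ) : Prop :=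
  ∑ i ∈ Finset.range (d + 1), P i = D ∧ ∀ i < d, DivBlock p f (P i + if i = 0 then E else 0)

/-- The total weight of a division into classes. -/
def weight (p d : ℕ) (P : ℕ → Multiset ℕ) : ℕ := ∑ i ∈ Finset.range (d + 1), i * pval p (P i)

/-- A valid division of maximal weight. -/
def Optimal (p f : ℕ) (E D : Multiset ℕ) (d : ℕ) (O : ℕ → Multiset ℕ) : Prop :=
  Valid p f E D d O ∧ ∀ P, Valid p f E D d P → weight p d P ≤ weight p d O

/-- The classes `P 0, …, P (d - 1)` of `P`, followed by `M`. -/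
def withTop (d : ℕ) (P : ℕ → Multiset ℕ) (M : Multiset ℕ) (i : ℕ) : Multiset ℕ :=
  if i < d then P i else M

theorem sum_withTop (d : ℕ) (P : ℕ → Multiset ℕ) (M : Multiset ℕ) :
    ∑ i ∈ Finset.range (d + 1), withTop d P M i = ∑ i ∈ Finset.range d, P i + M := by
  rw [Finset.sum_range_succ, withTop, if_neg (lt_irrefl d)]
  congr 1
  exact Finset.sum_congr rfl fun i hi => if_pos (Finset.mem_range.1 hi)

theorem weight_withTop (d : ℕ) (P : ℕ → Multiset ℕ) (M : Multiset ℕ) :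
    weight p d (withTop d P M) = ∑ i ∈ Finset.range d, i * pval p (P i) + d * pval p M := by
  rw [weight, Finset.sum_range_succ, withTop, if_neg (lt_irrefl d)]
  congr 1
  exact Finset.sum_congr rfl fun i hi => by rw [withTop, if_pos (Finset.mem_range.1 hi)]

theorem valid_withTop {E D : Multiset ℕ} {d : ℕ} {P : ℕ → Multiset ℕ} {M : Multiset ℕ}
    (h : ∑ i ∈ Finset.range d, P i + M = D)
    (hP : ∀ i < d, DivBlock p f (P i + if i = 0 then E else 0)) :
    Valid p f E D d (withTop d P M) :=
  ⟨by rw [sum_withTop, h], fun i hi => by rw [withTop, if_pos hi]; exact hP i hi⟩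

end partition

/-! ### The exchange argument for optimal divisions. -/

section optimal

variable {p f : ℕ}

theorem sum_comp_swap {α : Type*} [AddCommMonoid α] {d i j : ℕ} (hi : i ≤ d) (hj : j ≤ d)
    (g : ℕ → α) :
    ∑ k ∈ Finset.range (d + 1), g (Equiv.swap i j k) = ∑ k ∈ Finset.range (d + 1), g k := by
  refine Equiv.Perm.sum_comp (Equiv.swap i j) _ g fun k hk => ?_
  rw [Finset.coe_range, Set.mem_Iio]
  by_contra hlt
  exact hk (Equiv.swap_apply_of_ne_of_ne (by omega) (by omega))

theorem weight_swap {d i j : ℕ} (hij : i < j) (hj : j ≤ d) (O : ℕ → Multiset ℕ) :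
    weight p d (fun k => O (Equiv.swap i j k)) + i * pval p (O i) + j * pval p (O j) =
      weight p d O + j * pval p (O i) + i * pval p (O j) := by
  have h1 : weight p d (fun k => O (Equiv.swap i j k)) =
      ∑ k ∈ Finset.range (d + 1), Equiv.swap i j k * pval p (O k) := by
    rw [← sum_comp_swap (by omega : i ≤ d) hj]
    simp [weight]
  have h2 : ∀ g : ℕ → ℕ, ∀ l ≤ d, g l = ∑ k ∈ Finset.range (d + 1), if k = l then g l else 0 := by
    intro g l hl
    rw [Finset.sum_ite_eq', if_pos (Finset.mem_range.2 (by omega))]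
  rw [h1, weight, h2 (fun _ => i * pval p (O i)) i (by omega),
    h2 (fun _ => j * pval p (O j)) j hj, h2 (fun _ => j * pval p (O i)) i (by omega),
    h2 (fun _ => i * pval p (O j)) j hj]
  simp only [← Finset.sum_add_distrib]
  refine Finset.sum_congr rfl fun k _ => ?_
  by_cases hki : k = i
  · subst hki
    rw [Equiv.swap_apply_left]
    simp [hij.ne]
    ring
  · by_cases hkj : k = j
    · subst hkj
      rw [Equiv.swap_apply_right]
      simp [hki]
      ring
    · rw [Equiv.swap_apply_of_ne_of_ne hki hkj]
      simp [hki, hkj]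

variable [NeZero f]

/-- No position `e` outside the top class of an optimal division can be moved to the top class,
even after all positions of the top class below `e` have been taken out. -/
theorem Optimal.not_feasible (hp : 2 ≤ p) {E D : Multiset ℕ} {m : ℕ} {O : ℕ → Multiset ℕ}
    (hE : ∀ c j, cnt (relType f c) j E + 1 ≤ p) (hD : ∀ x, D.count x + 1 ≤ p)
    (hO : Optimal p f E D (m + 1) O) (e : ℕ) (heC : e ∈ ∑ i ∈ Finset.range (m + 1), O i) :
    ¬ ∀ j : ZMod f, (m + 1) * (p ^ f - 1) + p ^ ((e : ZMod f) + j).val ≤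
      sz p (relType f 0) j (∑ i ∈ Finset.range (m + 1), O i + (O (m + 1)).filter (· < e)) +
        sz p (relType f 0) j E := by
  intro hfe₀
  set C := ∑ i ∈ Finset.range (m + 1), O i with hC
  have hQ1 : 1 ≤ p ^ f - 1 := by
    simpa using pow_val_le (f := f) hp 0
  -- choose `e` maximal
  let feas : ℕ → Prop := fun e => e ∈ C ∧ ∀ j : ZMod f,
    (m + 1) * (p ^ f - 1) + p ^ ((e : ZMod f) + j).val ≤
      sz p (relType f 0) j (C + (O (m + 1)).filter (· < e)) + sz p (relType f 0) j E
  obtain ⟨e, ⟨heC, hfe⟩, hmax⟩ : ∃ e, feas e ∧ ∀ z, e < z → ¬ feas z := by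
    classical
    obtain ⟨b, hb⟩ : ∃ b, ∀ z ∈ C, z ≤ b := by
      refine ⟨C.sum, fun z hz => Multiset.single_le_sum (fun _ _ => Nat.zero_le _) _ hz⟩
    have h1 : feas (Nat.findGreatest feas b) :=
      Nat.findGreatest_spec (P := feas) (hb e heC) ⟨heC, hfe₀⟩
    refine ⟨_, h1, fun z hz hzf => ?_⟩
    exact Nat.findGreatest_is_greatest hz (hb z hzf.1) hzf
  clear hfe₀
  set F := (O (m + 1)).filter (· < e) with hF
  set G := (O (m + 1)).filter (fun x => ¬ x < e) with hG
  have hFG : F + G = O (m + 1) := Multiset.filter_add_not _ _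
  obtain ⟨⟨hsum, hblk⟩, hopt⟩ := hO
  rw [Finset.sum_range_succ, ← hC, ← hFG] at hsum
  have hcount : ∀ x, C.count x + F.count x + 1 ≤ p := by
    intro x
    have := hD x
    rw [← hsum] at this
    simp only [Multiset.count_add] at this
    omega
  have hlow : ∀ M ≤ C + F, pval p (M.filter (· < e)) < p ^ e := fun M hM =>
    pval_filter_lt (fun x => by
      have h1 := Multiset.count_le_of_le x hM
      have h2 := hcount x
      rw [Multiset.count_add] at h1
      omega) e
  -- the blocks, with types relative to `e`
  set ty := relType f (e : ZMod f) with hty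
  have he : ty e = 0 := sub_self _
  have hblk' : ∀ i, ∃ α : ZMod f → ℕ, i < m + 1 → ∀ j, 1 ≤ α j ∧
      sz p ty j (O i + if i = 0 then E else 0) = (p ^ f - 1) * α j := by
    intro i
    by_cases hi : i < m + 1
    · obtain ⟨α, hα⟩ := (isBlock_iff hp (e : ZMod f) _).2 (hblk i hi)
      exact ⟨α, fun _ => hα⟩
    · exact ⟨fun _ => 1, fun h => absurd h hi⟩
  choose b hb using hblk'
  have hA : ∀ j, sz p ty j C + sz p ty j E =
      (p ^ f - 1) * ∑ i ∈ Finset.range (m + 1), b i j := by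
    intro j
    rw [Finset.mul_sum, hC, sz_sum, Finset.sum_range_succ', Finset.sum_range_succ' (fun i => _ * _)]
    have h1 : ∀ i ∈ Finset.range m, sz p ty j (O (i + 1)) = (p ^ f - 1) * b (i + 1) j := by
      intro i hi
      have := (hb (i + 1) (by have := Finset.mem_range.1 hi; omega) j).2
      simpa using this
    have h2 := (hb 0 (by omega) j).2
    simp only [if_true, sz_add] at h2
    rw [Finset.sum_congr rfl h1, ← h2]
    ring
  have hA1 : ∀ j, m + 1 ≤ ∑ i ∈ Finset.range (m + 1), b i j := by
    intro j
    calc m + 1 = ∑ i ∈ Finset.range (m + 1), 1 := by simp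
      _ ≤ _ := Finset.sum_le_sum fun i hi => (hb i (Finset.mem_range.1 hi) j).1
  have hfe' : ∀ j : ZMod f, (m + 1) * (p ^ f - 1) + p ^ j.val ≤
      (p ^ f - 1) * ∑ i ∈ Finset.range (m + 1), b i j + sz p ty j F := by
    intro j
    have := hfe (j - e)
    rw [sz_add, ← sz_relType, ← sz_relType, ← sz_relType, add_sub_cancel, ← hty] at this
    rw [← hA]
    omega
  -- By maximality `z` fails at some rotation `j`. The total there is so small that every block has
  -- `b i j = 1`. Feasibility of `e` then bounds `F` from below, and failure of `z` bounds it from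
  -- above.
  have hz : ∀ z ∈ C, e < z → ∃ j, p ^ j.val ≤ sz p ty j F ∧ (∀ i < m + 1, b i j = 1) ∧
      sz p ty j F < p ^ (ty z + j).val := by
    intro z hzC hez
    have hnf : ¬ ∀ j : ZMod f, (m + 1) * (p ^ f - 1) + p ^ ((z : ZMod f) + j).val ≤
      sz p (relType f 0) j (C + (O (m + 1)).filter (· < z)) + sz p (relType f 0) j E :=
      fun h => hmax z hez ⟨hzC, h⟩
    push Not at hnf
    obtain ⟨j₀, hj₀⟩ := hnf
    have hle : F ≤ (O (m + 1)).filter (· < z) :=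
      Multiset.monotone_filter_right _ fun x hx => lt_trans hx hez
    have h1 : sz p (relType f 0) j₀ F ≤ _ := sz_mono hle
    obtain ⟨j, rfl⟩ : ∃ j, j₀ = j - (e : ZMod f) := ⟨j₀ + e, by ring⟩
    rw [← sz_relType, ← sz_relType, ← hty] at h1
    rw [sz_add, ← sz_relType, ← sz_relType, ← sz_relType, ← hty] at hj₀
    have h2 : (z : ZMod f) + (j - e) = ty z + j := by rw [hty, relType]; ring
    rw [h2] at hj₀
    have h3 := hA j
    have h4 := hA1 j
    have h5 := pow_val_le hp (ty z + j)
    have h6 : ∑ i ∈ Finset.range (m + 1), b i j = m + 1 := by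
      by_contra hne
      have h7 : m + 2 ≤ ∑ i ∈ Finset.range (m + 1), b i j := by omega
      have h8 := Nat.mul_le_mul_left (p ^ f - 1) h7
      have h9 : (p ^ f - 1) * (m + 2) = (m + 1) * (p ^ f - 1) + (p ^ f - 1) := by ring
      omega
    have h7 : (p ^ f - 1) * (m + 1) = (m + 1) * (p ^ f - 1) := by ring
    have h8 := hfe' j
    rw [h6] at h3 h8
    refine ⟨j, by omega, fun i hi => ?_, by omega⟩
    by_contra hne
    have h9 : 1 < b i j := lt_of_le_of_ne (hb i hi j).1 (Ne.symm hne)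
    have : ∑ i ∈ Finset.range (m + 1), 1 < ∑ i ∈ Finset.range (m + 1), b i j :=
      Finset.sum_lt_sum (fun i hi => (hb i (Finset.mem_range.1 hi) j).1)
        ⟨i, Finset.mem_range.2 hi, h9⟩
    simp at this
    omega
  have hJb : ∀ j, sz p ty j F < p ^ j.val → ∃ i < m + 1, 2 ≤ b i j := by
    intro j hj
    by_contra hall
    push Not at hall
    have h1 : ∑ i ∈ Finset.range (m + 1), b i j ≤ ∑ i ∈ Finset.range (m + 1), 1 :=
      Finset.sum_le_sum fun i hi => by have := hall i (Finset.mem_range.1 hi); omega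
    have h2 := Nat.mul_le_mul_left (p ^ f - 1) h1
    have h3 := hfe' j
    simp only [Finset.sum_const, Finset.card_range, smul_eq_mul, mul_one] at h2
    rw [mul_comm _ (m + 1)] at h2
    omega
  have hCO : ∀ {i x}, i < m + 1 → x ∈ O i → x ∈ C := fun hi hx =>
    Multiset.mem_sum.2 ⟨_, Finset.mem_range.2 hi, hx⟩
  have hOC : ∀ {i}, i < m + 1 → O i ≤ C := fun {i} hi =>
    Finset.single_le_sum (f := O) (fun _ _ => Multiset.zero_le _) (Finset.mem_range.2 hi)
  have hWO : weight p (m + 1) O =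
      ∑ i ∈ Finset.range (m + 1), i * pval p (O i) + (m + 1) * (pval p F + pval p G) := by
    rw [weight, Finset.sum_range_succ, ← hFG, pval_add]
  -- Size below `1` means that `F` is empty, and then `hz` leaves nothing in `C` above `e`. If `e`
  -- is not in `O m`, swapping classes shows that among the lower classes it lies only in `O 0`, so
  -- classes `1, …, m` are worth less than `p ^ e` together. Any partition with `e` placed on top
  -- then has larger weight.
  have hlast : sz p ty 0 F < p ^ (0 : ZMod f).val → m = 0 ∨ e ∈ O m := by
    intro hJ0
    by_contra! hcon
    obtain ⟨hm, hem⟩ := hcon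
    have hle : ∀ x ∈ C, x ≤ e := by
      intro x hx
      by_contra! hlt
      obtain ⟨j, h1, -⟩ := hz x hx hlt
      have := sz_lt_of_sz_zero_lt hp hJ0 j
      omega
    have hlowm : pval p (O m) < p ^ e := by
      have h1 : (O m).filter (· < e) = O m := Multiset.filter_eq_self.2 fun x hx =>
        lt_of_le_of_ne (hle x (hCO (by omega) hx)) fun h => hem (h ▸ hx)
      rw [← h1]
      exact hlow _ ((hOC (by omega)).trans (Multiset.le_add_right _ _))
    have hnot : ∀ i, 1 ≤ i → i ≤ m → e ∉ O i := by
      intro i hi him hei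
      have hlt : i < m := lt_of_le_of_ne him fun h => hem (h ▸ hei)
      have hval : Valid p f E D (m + 1) (fun k => O (Equiv.swap i m k)) := by
        refine ⟨?_, fun k hk => ?_⟩
        · rw [sum_comp_swap (by omega) (by omega), Finset.sum_range_succ, ← hC, ← hFG, hsum]
        · by_cases hk0 : k = 0
          · subst hk0
            have h0 : Equiv.swap i m 0 = 0 := Equiv.swap_apply_of_ne_of_ne (by omega) (by omega)
            simp only [h0]
            exact hblk 0 (by omega)
          · have h0 : Equiv.swap i m k ≠ 0 := fun h => by
              have := congrArg (Equiv.swap i m) h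
              rw [Equiv.swap_apply_self, Equiv.swap_apply_of_ne_of_ne (by omega) (by omega)] at this
              exact hk0 this
            have h1 : Equiv.swap i m k < m + 1 := by
              rw [Equiv.swap_apply_def]
              split_ifs <;> omega
            have := hblk _ h1
            rw [if_neg h0] at this
            rwa [if_neg hk0]
      have h1 := hopt _ hval
      have h2 := weight_swap (p := p) hlt (by omega : m ≤ m + 1) O
      have h3 := pow_le_pval (p := p) hei
      obtain ⟨t, rfl⟩ := Nat.exists_eq_add_of_lt hlt
      have h4 : (t + 1) * pval p (O (i + t + 1)) < (t + 1) * pval p (O i) :=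
        Nat.mul_lt_mul_of_pos_left (by omega) (by omega)
      nlinarith
    have hF0 : F = 0 := by
      refine Multiset.eq_zero_of_forall_notMem fun x hx => ?_
      have h1 := le_sz_of_mem (p := p) (ty := ty) (j := 0) hx
      have h2 : 0 < p ^ (ty x + 0).val := by positivity
      simp at hJ0
      omega
    obtain ⟨C', hC'⟩ := Multiset.exists_cons_of_mem heC
    obtain ⟨P, hP, hPb⟩ := exists_partition hp (m + 1) E (C' + F) (hE 0) (fun j => by
      have h1 := hfe j
      rw [hC', ← Multiset.singleton_add] at h1
      simp only [sz_add, sz_singleton, relType, sub_zero] at h1 ⊢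
      omega)
    have hval := valid_withTop (p := p) (f := f) (E := E) (D := D) (d := m + 1) (P := P)
      (M := P (m + 1) + {e} + G) (by
        rw [← hsum, hC', ← Multiset.singleton_add]
        rw [Finset.sum_range_succ] at hP
        calc _ = (∑ i ∈ Finset.range (m + 1), P i + P (m + 1)) + {e} + G := by abel
          _ = _ := by rw [hP]; abel) hPb
    have h1 := hopt _ hval
    rw [weight_withTop, hWO, hF0] at h1
    simp only [pval_add, pval_singleton, pval_zero] at h1
    have h2 : ∑ i ∈ Finset.range (m + 1), i * pval p (O i) ≤ m * p ^ e := by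
      rw [Finset.sum_range_succ', zero_mul, add_zero]
      have h3 : pval p (∑ i ∈ Finset.range m, O (i + 1)) < p ^ e := by
        have h4 : (∑ i ∈ Finset.range m, O (i + 1)).filter (· < e) =
            ∑ i ∈ Finset.range m, O (i + 1) := by
          refine Multiset.filter_eq_self.2 fun x hx => ?_
          obtain ⟨i, hi, hxi⟩ := Multiset.mem_sum.1 hx
          rw [Finset.mem_range] at hi
          exact lt_of_le_of_ne (hle x (hCO (by omega) hxi))
            fun h => hnot (i + 1) (by omega) (by omega) (h ▸ hxi)
        rw [← h4]
        refine hlow _ ?_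
        rw [hC, Finset.sum_range_succ', add_assoc]
        exact Multiset.le_add_right _ _
      rw [pval_sum] at h3
      calc _ ≤ ∑ i ∈ Finset.range m, m * pval p (O (i + 1)) :=
            Finset.sum_le_sum fun i hi => Nat.mul_le_mul_right _ (Finset.mem_range.1 hi)
        _ = m * ∑ i ∈ Finset.range m, pval p (O (i + 1)) := by rw [Finset.mul_sum]
        _ ≤ _ := Nat.mul_le_mul_left _ h3.le
    have h3 : 0 < p ^ e := by positivity
    have h4 : (m + 1) * (p ^ e + pval p G) ≤ (m + 1) * (pval p (P (m + 1)) + p ^ e + pval p G) :=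
      Nat.mul_le_mul_left _ (by omega)
    have h5 : (m + 1) * (p ^ e + pval p G) = m * p ^ e + p ^ e + (m + 1) * pval p G := by ring
    rw [zero_add] at h1
    omega
  have hCs : O 0 + ∑ i ∈ Finset.range m, O (i + 1) = C := by
    rw [hC, Finset.sum_range_succ', add_comm]
  -- the exchange
  obtain ⟨P', F', hsum', hP0, hPi, hW⟩ := bubble hp he (F := F)
    (fun x hx => (Multiset.mem_filter.1 hx).2) m E (O 0) (fun i => O (i + 1)) (b 0)
    (fun i => b (i + 1)) (hE _) (by simpa using hb 0 (by omega))
    (fun i hi => by simpa using hb (i + 1) (by omega))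
    (fun j hj => by
      obtain ⟨i, hi, h⟩ := hJb j hj
      cases i with
      | zero => exact Or.inl h
      | succ i => exact Or.inr ⟨i, by omega, h⟩)
    (fun i hi z hzi hez => by
      obtain ⟨j, h1, h2, h3⟩ := hz z (hCO (by omega) hzi) hez
      exact ⟨j, h1, fun i hi => h2 (i + 1) (by omega), h3⟩)
    (by
      obtain ⟨i, hi, h⟩ := Multiset.mem_sum.1 heC
      rw [Finset.mem_range] at hi
      cases i with
      | zero => exact Or.inl h
      | succ i => exact Or.inr ⟨i, by omega, h⟩)
    (by
      have := hcount e
      rw [hCs]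
      omega)
    (fun hJ0 => by
      rcases hlast hJ0 with h | h
      · exact Or.inl h
      · cases m with
        | zero => exact Or.inl rfl
        | succ m => exact Or.inr h)
  rw [hCs] at hsum'
  have hval := valid_withTop (p := p) (f := f) (E := E) (D := D) (d := m + 1) (P := P')
    (M := F' + G) (by rw [← hsum, ← add_assoc, ← add_assoc, hsum']) (fun i hi => by
      rw [← isBlock_iff hp (e : ZMod f)]
      by_cases hi0 : i = 0
      · subst hi0; exact hP0
      · rw [if_neg hi0, add_zero]; exact hPi i (by omega) (by omega))
  -- The exchange gains `p ^ e` and loses at most the value of positions below `e`, which is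
  -- smaller: a contradiction.
  have h1 := hopt _ hval
  rw [weight_withTop, hWO, pval_add, Finset.sum_range_succ' (fun i => i * pval p (O i)),
    zero_mul, add_zero] at h1
  have h2 := hlow (∑ i ∈ Finset.range m, O (i + 1) + F) (by
    rw [← hCs, add_assoc]; exact Multiset.le_add_left _ _)
  rw [mul_add, mul_add] at h1
  omega

end optimal

/-! ### Optimal divisions are lexicographically largest. -/

section lex

variable {p f : ℕ}

/-- `M` and `N` agree above `e`, and `N` has more copies of `e` than `M`. -/
def TopLT (M N : Multiset ℕ) (e : ℕ) : Prop :=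
  M.count e < N.count e ∧ ∀ z, e < z → M.count z = N.count z

theorem exists_topLT {M N : Multiset ℕ} (h : M ≠ N) : ∃ e, TopLT M N e ∨ TopLT N M e := by
  classical
  have hex : ∃ x, M.count x ≠ N.count x := by
    by_contra! hall
    exact h (Multiset.ext.2 hall)
  obtain ⟨x, hx⟩ := hex
  set P : ℕ → Prop := fun x => M.count x ≠ N.count x
  have hb : ∀ z, P z → z ≤ M.sum + N.sum := by
    intro z hz
    by_cases hzM : z ∈ M
    · exact (Multiset.single_le_sum (fun _ _ => Nat.zero_le _) _ hzM).trans (Nat.le_add_right _ _)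
    · by_cases hzN : z ∈ N
      · exact (Multiset.single_le_sum (fun _ _ => Nat.zero_le _) _ hzN).trans (Nat.le_add_left _ _)
      · exact absurd (by rw [Multiset.count_eq_zero_of_notMem hzM,
          Multiset.count_eq_zero_of_notMem hzN]) hz
  set e := Nat.findGreatest P (M.sum + N.sum)
  have he : P e := Nat.findGreatest_spec (hb x hx) hx
  have hgt : ∀ z, e < z → M.count z = N.count z := by
    intro z hz
    by_contra hne
    exact Nat.findGreatest_is_greatest hz (hb z hne) hne
  rcases lt_or_gt_of_ne he with h1 | h1
  · exact ⟨e, Or.inl ⟨h1, hgt⟩⟩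
  · exact ⟨e, Or.inr ⟨h1, fun z hz => (hgt z hz).symm⟩⟩

theorem TopLT.add_le {M N : Multiset ℕ} {e : ℕ} (h : TopLT M N e) :
    M.filter (fun x => ¬ x < e) + {e} ≤ N := by
  refine Multiset.le_iff_count.2 fun x => ?_
  rw [Multiset.count_add, Multiset.count_filter, Multiset.count_singleton]
  rcases lt_trichotomy x e with hx | rfl | hx
  · simp [hx, hx.ne]
  · have := h.1
    simp; omega
  · simp [hx.not_gt, hx.ne', h.2 x hx]

theorem TopLT.pval_lt {M N : Multiset ℕ} {e : ℕ} (h : TopLT M N e)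
    (hM : ∀ x, M.count x + 1 ≤ p) : pval p M < pval p N := by
  have h1 := pval_mono (p := p) h.add_le
  have h2 := pval_filter_lt hM e
  have h3 := pval_filter_add (p := p) e M
  rw [pval_add, pval_singleton] at h1
  omega

theorem eq_of_pval_eq {M N : Multiset ℕ} (hM : ∀ x, M.count x + 1 ≤ p)
    (hN : ∀ x, N.count x + 1 ≤ p) (h : pval p M = pval p N) : M = N := by
  by_contra hne
  obtain ⟨e, he | he⟩ := exists_topLT hne
  · exact absurd (he.pval_lt hM) (by omega)
  · exact absurd (he.pval_lt hN) (by omega)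

theorem class_le {E D : Multiset ℕ} {d : ℕ} {P : ℕ → Multiset ℕ} (h : Valid p f E D d P) {i : ℕ}
    (hi : i ≤ d) : P i ≤ D := by
  rw [← h.1]
  exact Finset.single_le_sum (f := P) (fun _ _ => Multiset.zero_le _)
    (Finset.mem_range.2 (by omega))

theorem count_class {E D : Multiset ℕ} {d : ℕ} {P : ℕ → Multiset ℕ} (h : Valid p f E D d P)
    (hD : ∀ x, D.count x + 1 ≤ p) {i : ℕ} (hi : i ≤ d) (x : ℕ) : (P i).count x + 1 ≤ p :=
  (Nat.succ_le_succ (Multiset.count_le_of_le x (class_le h hi))).trans (hD x)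

theorem exists_optimal {E D : Multiset ℕ} {d : ℕ} {P : ℕ → Multiset ℕ}
    (h : Valid p f E D d P) : ∃ O, Optimal p f E D d O := by
  classical
  set S : ℕ → Prop := fun w => ∃ P, Valid p f E D d P ∧ weight p d P = w with hS
  have hb : ∀ P, Valid p f E D d P → weight p d P ≤ d * pval p D := by
    intro P hP
    rw [← hP.1, pval_sum, Finset.mul_sum]
    exact Finset.sum_le_sum fun i hi =>
      Nat.mul_le_mul_right _ (Nat.lt_succ_iff.1 (Finset.mem_range.1 hi))
  obtain ⟨O, hO, hw⟩ : S (Nat.findGreatest S (d * pval p D)) :=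
    Nat.findGreatest_spec (hb P h) ⟨P, h, rfl⟩
  refine ⟨O, hO, fun P hP => ?_⟩
  rw [hw]
  exact Nat.le_findGreatest (hb P hP) ⟨P, hP, rfl⟩

variable [NeZero f]

/-- The top class of an optimal division has the largest value. -/
theorem Optimal.pval_top_le (hp : 2 ≤ p) {E D : Multiset ℕ} {d : ℕ} {O G : ℕ → Multiset ℕ}
    (hE : ∀ c j, cnt (relType f c) j E + 1 ≤ p) (hD : ∀ x, D.count x + 1 ≤ p)
    (hO : Optimal p f E D d O) (hG : Valid p f E D d G) : pval p (G d) ≤ pval p (O d) := by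
  cases d with
  | zero =>
    have h1 := hO.1.1
    have h2 := hG.1
    rw [Finset.sum_range_one] at h1 h2
    rw [h1, h2]
  | succ m =>
    by_contra! hlt
    have hne : O (m + 1) ≠ G (m + 1) := fun h => by rw [h] at hlt; exact lt_irrefl _ hlt
    obtain ⟨e, he⟩ : ∃ e, TopLT (O (m + 1)) (G (m + 1)) e := by
      obtain ⟨e, he | he⟩ := exists_topLT hne
      · exact ⟨e, he⟩
      · exact absurd (he.pval_lt (count_class hG hD le_rfl)) (by omega)
    have hsO := hO.1.1
    have hsG := hG.1
    rw [Finset.sum_range_succ] at hsO hsG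
    -- The top class of `G` contains the part of `O (m + 1)` from `e` upward and one more `e`. Hence
    -- what `O` leaves available, without that `e`, is at least as large at every rotation as the
    -- lower classes of `G`, which with `E` form `m + 1` blocks.
    refine hO.not_feasible hp hE hD e ?_ fun j => ?_
    · rw [← Multiset.count_pos]
      have h1 := congrArg (Multiset.count e) (hsO.trans hsG.symm)
      rw [Multiset.count_add, Multiset.count_add] at h1
      have := he.1
      omega
    · have h1 := congrArg (sz p (relType f 0) j) (hsO.trans hsG.symm)
      have h2 := sz_mono (p := p) (ty := relType f 0) (j := j) he.add_le
      have h3 : sz p (relType f 0) j (O (m + 1)) =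
          sz p (relType f 0) j ((O (m + 1)).filter (· < e)) +
          sz p (relType f 0) j ((O (m + 1)).filter fun x => ¬ x < e) := by
        rw [← sz_add, Multiset.filter_add_not]
      have h4 : (m + 1) * (p ^ f - 1) ≤
          sz p (relType f 0) j (∑ i ∈ Finset.range (m + 1), G i) + sz p (relType f 0) j E := by
        have h5 : ∑ i ∈ Finset.range (m + 1), sz p (relType f 0) j (G i + if i = 0 then E else 0) =
            sz p (relType f 0) j (∑ i ∈ Finset.range (m + 1), G i) + sz p (relType f 0) j E := by
          rw [sz_sum, Finset.sum_range_succ', Finset.sum_range_succ' (fun i => sz p _ j (G i))]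
          simp [add_assoc]
        rw [← h5]
        calc (m + 1) * (p ^ f - 1) = ∑ i ∈ Finset.range (m + 1), (p ^ f - 1) := by simp
          _ ≤ _ := Finset.sum_le_sum fun i hi => by
            obtain ⟨α, hα⟩ := (isBlock_iff hp 0 _).2 (hG.2 i (Finset.mem_range.1 hi))
            rw [(hα j).2]
            exact Nat.le_mul_of_pos_right _ (hα j).1
      simp only [sz_add, sz_singleton, relType, sub_zero] at h1 h2 h3 h4 ⊢
      omega

/-- A better division of the lower classes could be put under the old top class. This needs its own
last class to become a block: divisibility follows from the total, and nonemptiness from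
`Optimal.pval_top_le`. -/
theorem Optimal.init (hp : 2 ≤ p) {E D : Multiset ℕ} {d : ℕ} {O : ℕ → Multiset ℕ}
    (hE : ∀ c j, cnt (relType f c) j E + 1 ≤ p) (hD : ∀ x, D.count x + 1 ≤ p)
    (hO : Optimal p f E D (d + 1) O) :
    Optimal p f E (∑ i ∈ Finset.range (d + 1), O i) d O := by
  obtain ⟨⟨hs, hb⟩, hopt⟩ := hO
  rw [Finset.sum_range_succ] at hs
  have hD' : ∀ x, (∑ i ∈ Finset.range (d + 1), O i).count x + 1 ≤ p := fun x =>
    (Nat.succ_le_succ (Multiset.count_le_of_le x (hs ▸ Multiset.le_add_right _ _))).trans (hD x)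
  have hval : Valid p f E (∑ i ∈ Finset.range (d + 1), O i) d O :=
    ⟨rfl, fun i hi => hb i (by omega)⟩
  obtain ⟨P, hP⟩ := exists_optimal hval
  have hw : weight p d P ≤ weight p d O := by
    have hPd : DivBlock p f (P d + if d = 0 then E else 0) := by
      have hdvd : ∀ Q : ℕ → Multiset ℕ,
          pval p (∑ i ∈ Finset.range (d + 1), (Q i + if i = 0 then E else 0)) =
            pval p (∑ i ∈ Finset.range (d + 1), Q i) + pval p E := by
        intro Q
        rw [Finset.sum_add_distrib, pval_add, Finset.sum_ite_eq',
          if_pos (Finset.mem_range.2 (by omega))]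
      have h1 : (p ^ f - 1) ∣ pval p (∑ i ∈ Finset.range (d + 1), (P i + if i = 0 then E else 0)) := by
        rw [hdvd, hP.1.1, ← hdvd, pval_sum]
        exact Finset.dvd_sum fun i hi => (hb i (Finset.mem_range.1 hi)).1
      refine ⟨?_, ?_⟩
      · rw [Finset.sum_range_succ, pval_add, pval_sum] at h1
        exact (Nat.dvd_add_right (Finset.dvd_sum fun i hi =>
          (hP.1.2 i (Finset.mem_range.1 hi)).1)).1 h1
      · have hle := hP.pval_top_le hp hE hD' hval
        intro h0
        rw [add_eq_zero] at h0
        rw [h0.1, pval_zero, Nat.le_zero] at hle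
        refine (hb d (by omega)).2 ?_
        rw [h0.2, add_zero]
        by_contra hne
        obtain ⟨x, hx⟩ := Multiset.exists_mem_of_ne_zero hne
        have := pow_le_pval (p := p) hx
        have : 0 < p ^ x := by positivity
        omega
    have hv := valid_withTop (p := p) (f := f) (E := E) (D := D) (d := d + 1) (P := P)
      (M := O (d + 1)) (by rw [hP.1.1, hs]) (fun i hi => by
        rcases Nat.lt_succ_iff_lt_or_eq.1 hi with h | rfl
        · exact hP.1.2 i h
        · exact hPd)
    have h1 := hopt _ hv
    rw [weight_withTop, weight, Finset.sum_range_succ _ (d + 1)] at h1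
    exact Nat.le_of_add_le_add_right h1
  exact ⟨hval, fun G hG => (hP.2 G hG).trans hw⟩

/-- An optimal division is lexicographically largest, read from the top. -/
theorem Optimal.lex (hp : 2 ≤ p) {E : Multiset ℕ}
    (hE : ∀ c j, cnt (relType f c) j E + 1 ≤ p) (d : ℕ) : ∀ (D : Multiset ℕ)
    (O G : ℕ → Multiset ℕ), (∀ x, D.count x + 1 ≤ p) → Optimal p f E D d O → Valid p f E D d G →
    (∀ i ≤ d, G i = O i) ∨
      ∃ j ≤ d, pval p (G j) < pval p (O j) ∧ ∀ i, j < i → i ≤ d → G i = O i := by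
  induction d with
  | zero =>
    intro D O G _ hO hG
    have h1 := hO.1.1
    have h2 := hG.1
    rw [Finset.sum_range_one] at h1 h2
    left
    intro i hi
    rw [Nat.le_zero.1 hi, h1, h2]
  | succ d ih =>
    intro D O G hD hO hG
    rcases (hO.pval_top_le hp hE hD hG).lt_or_eq with h | h
    · exact Or.inr ⟨d + 1, le_rfl, h, fun i hi hi' => by omega⟩
    have htop : G (d + 1) = O (d + 1) :=
      eq_of_pval_eq (count_class hG hD le_rfl) (count_class hO.1 hD le_rfl) h
    have hs := hO.1.1
    have hsG := hG.1
    rw [Finset.sum_range_succ] at hs hsG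
    have hG' : Valid p f E (∑ i ∈ Finset.range (d + 1), O i) d G :=
      ⟨by rw [htop] at hsG; exact add_right_cancel (hsG.trans hs.symm),
        fun i hi => hG.2 i (by omega)⟩
    have hD' : ∀ x, (∑ i ∈ Finset.range (d + 1), O i).count x + 1 ≤ p := fun x =>
      (Nat.succ_le_succ (Multiset.count_le_of_le x (hs ▸ Multiset.le_add_right _ _))).trans (hD x)
    rcases ih _ O G hD' (hO.init hp hE hD) hG' with h1 | ⟨j, hj, h1, h2⟩
    · left
      intro i hi
      rcases Nat.le_succ_iff.1 hi with h | rfl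
      · exact h1 i h
      · exact htop
    · right
      refine ⟨j, by omega, h1, fun i hij hi => ?_⟩
      rcases Nat.le_succ_iff.1 hi with h | rfl
      · exact h2 i hij h
      · exact htop

end lex

/-! ### Tuples as divisions of the digits of `k`. -/

section digits

variable {p f : ℕ}

/-- The base `p` digits of `n`: position `j` occurs as often as the digit at `j` says. -/
def dig (p n : ℕ) : Multiset ℕ := ∑ j ∈ Finset.range (n + 1), Multiset.replicate (n / p ^ j % p) j

theorem count_dig (hp : 2 ≤ p) (n j : ℕ) : (dig p n).count j = n / p ^ j % p := by
  rw [dig, Multiset.count_sum']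
  by_cases hj : j ∈ Finset.range (n + 1)
  · rw [Finset.sum_eq_single_of_mem j hj fun i _ hi => ?_, Multiset.count_replicate_self]
    rw [Multiset.count_replicate, if_neg hi]
  · rw [Finset.sum_eq_zero fun i hi => ?_]
    · rw [Finset.mem_range, not_lt] at hj
      have : n < p ^ j := (Nat.lt_pow_self (by omega)).trans
        (Nat.pow_lt_pow_right (by omega) (by omega : n < j))
      rw [Nat.div_eq_of_lt this, Nat.zero_mod]
    · rw [Multiset.count_replicate, if_neg]
      rintro rfl
      exact hj hi

theorem count_dig_lt (hp : 2 ≤ p) (n j : ℕ) : (dig p n).count j + 1 ≤ p := by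
  rw [count_dig hp]
  exact Nat.mod_lt _ (by omega)

theorem pval_dig (hp : 2 ≤ p) (n : ℕ) : pval p (dig p n) = n := by
  have h : ∀ N, ∑ j ∈ Finset.range N, (n / p ^ j % p) * p ^ j = n % p ^ N := by
    intro N
    induction N with
    | zero => simp [Nat.mod_one]
    | succ N ih => rw [Finset.sum_range_succ, ih, Nat.mod_pow_succ, mul_comm]
  have h1 : n < p ^ (n + 1) := (Nat.lt_pow_self (by omega)).trans
    (Nat.pow_lt_pow_right (by omega) (by omega))
  rw [dig, pval_sum]
  refine Eq.trans ?_ ((h (n + 1)).trans (Nat.mod_eq_of_lt h1))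
  simp [pval]

theorem dig_pval (hp : 2 ≤ p) {M : Multiset ℕ} (hM : ∀ x, M.count x + 1 ≤ p) :
    dig p (pval p M) = M :=
  eq_of_pval_eq (count_dig_lt hp _) hM (pval_dig hp _)

theorem dig_eq_zero_iff (hp : 2 ≤ p) (n : ℕ) : dig p n = 0 ↔ n = 0 := by
  constructor
  · intro h
    rw [← pval_dig hp n, h, pval_zero]
  · rintro rfl
    simp [dig]

theorem lt_of_mem_dig (hp : 2 ≤ p) {n f x : ℕ} (hn : n < p ^ f) (hx : x ∈ dig p n) : x < f := by
  by_contra! hle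
  rw [← Multiset.count_pos, count_dig hp,
    Nat.div_eq_of_lt (hn.trans_le (Nat.pow_le_pow_right (by omega) hle))] at hx
  simp at hx

theorem noCarry_iff (hp : 2 ≤ p) {n : ℕ} (m : Fin n → ℕ) :
    NoCarry p m ↔ ∀ j, (∑ i, dig p (m i)).count j + 1 ≤ p := by
  simp only [NoCarry, Multiset.count_sum', count_dig hp, Nat.succ_le_iff]

theorem noCarry_iff_dig (hp : 2 ≤ p) {n : ℕ} (m : Fin n → ℕ) :
    NoCarry p m ↔ ∑ i, dig p (m i) = dig p (∑ i, m i) := by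
  have h : pval p (∑ i, dig p (m i)) = ∑ i, m i := by
    rw [pval_sum]
    exact Finset.sum_congr rfl fun i _ => pval_dig hp _
  rw [noCarry_iff hp]
  constructor
  · intro hc
    rw [← h, dig_pval hp hc]
  · intro he
    rw [he]
    exact count_dig_lt hp _

/-- The positions that complete the lowest class of a division of `dig p k` to a block. -/
def complement (p f k : ℕ) : Multiset ℕ := dig p (p ^ f - 1 - k % (p ^ f - 1))

theorem pval_complement (hp : 2 ≤ p) (f k : ℕ) :
    pval p (complement p f k) = p ^ f - 1 - k % (p ^ f - 1) := pval_dig hp _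

theorem one_lt_pow_base [NeZero f] (hp : 2 ≤ p) : 1 < p ^ f :=
  Nat.one_lt_pow (NeZero.ne f) (by omega)

theorem complement_ne_zero [NeZero f] (hp : 2 ≤ p) (k : ℕ) : complement p f k ≠ 0 := by
  have h1 := one_lt_pow_base (f := f) hp
  have := Nat.mod_lt k (by omega : 0 < p ^ f - 1)
  rw [complement, Ne, dig_eq_zero_iff hp]
  omega

theorem dvd_add_complement [NeZero f] (hp : 2 ≤ p) (k : ℕ) :
    (p ^ f - 1) ∣ k + pval p (complement p f k) := by
  have h1 := one_lt_pow_base (f := f) hp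
  have := Nat.mod_lt k (by omega : 0 < p ^ f - 1)
  rw [pval_complement hp]
  have h2 := Nat.div_add_mod k (p ^ f - 1)
  refine ⟨k / (p ^ f - 1) + 1, ?_⟩
  rw [mul_add, mul_one]
  omega

/-- The completed number is less than `p ^ f`, so its positions are below `f` and each type occurs
at a single position, as a digit less than `p`. -/
theorem cnt_complement [NeZero f] (hp : 2 ≤ p) (k : ℕ) (c j : ZMod f) :
    cnt (relType f c) j (complement p f k) + 1 ≤ p := by
  have h1 := one_lt_pow_base (f := f) hp
  rw [cnt_relType]
  have h2 : (complement p f k).countP (fun x : ℕ => (x : ZMod f) = c - j) =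
      (complement p f k).count (c - j).val := by
    rw [Multiset.count]
    refine Multiset.countP_congr rfl fun x hx => ?_
    have hxf : x < f := lt_of_mem_dig hp (by omega) hx
    rw [eq_iff_iff]
    constructor
    · intro h
      rw [← h, ZMod.val_natCast_of_lt hxf]
    · intro h
      rw [← h, ZMod.natCast_zmod_val]
  rw [h2]
  exact count_dig_lt hp _ _

/-- The division of digits belonging to a tuple. -/
def classes (p : ℕ) {d : ℕ} (m : Fin (d + 1) → ℕ) (i : ℕ) : Multiset ℕ :=
  if h : i < d + 1 then dig p (m ⟨i, h⟩) else 0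

theorem classes_val {d : ℕ} (m : Fin (d + 1) → ℕ) (i : Fin (d + 1)) :
    classes p m i = dig p (m i) := by
  rw [classes, dif_pos i.2]

theorem mem_Utilde {p q d k : ℕ} {m : Fin (d + 1) → ℕ} : m ∈ Utilde p q d k ↔
    ∑ i, m i = k ∧ NoCarry p m ∧ ∀ i, i ≠ 0 → (i ≠ Fin.last d → 0 < m i) ∧ (q - 1) ∣ m i := by
  simp [Utilde, Finset.mem_piAntidiag]

theorem mem_U {p q d k : ℕ} {m : Fin (d + 1) → ℕ} : m ∈ U p q d k ↔
    ∑ i, m i = k ∧ NoCarry p m ∧ ∀ i, i ≠ 0 → 0 < m i ∧ (q - 1) ∣ m i := by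
  simp [U, Finset.mem_piAntidiag]

theorem U_subset_Utilde {p q d k : ℕ} : U p q d k ⊆ Utilde p q d k := fun m hm => by
  rw [mem_U] at hm
  rw [mem_Utilde]
  exact ⟨hm.1, hm.2.1, fun i hi => ⟨fun _ => (hm.2.2 i hi).1, (hm.2.2 i hi).2⟩⟩

/-- Divisibility of `m_1, …, m_d` makes `m_0` congruent to `k`, so the complement completes class
`0` to a block. As the complement is nonzero, `m_0 = 0` is allowed. -/
theorem valid_classes [NeZero f] (hp : 2 ≤ p) {d k : ℕ} {m : Fin (d + 1) → ℕ}
    (hm : m ∈ Utilde p (p ^ f) d k) :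
    Valid p f (complement p f k) (dig p k) d (classes p m) := by
  obtain ⟨hs, hc, hm⟩ := mem_Utilde.1 hm
  refine ⟨?_, fun i hi => ?_⟩
  · rw [← Fin.sum_univ_eq_sum_range]
    simp only [classes_val]
    rw [(noCarry_iff_dig hp m).1 hc, hs]
  · rw [classes, dif_pos (by omega)]
    by_cases hi0 : i = 0
    · subst hi0
      rw [if_pos rfl]
      refine ⟨?_, fun h => complement_ne_zero (f := f) hp k (add_eq_zero.1 h).2⟩
      rw [pval_add, pval_dig hp]
      have h1 := dvd_add_complement (f := f) hp k
      have h2 : (p ^ f - 1) ∣ ∑ i : Fin d, m i.succ :=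
        Finset.dvd_sum fun i _ => (hm _ (Fin.succ_ne_zero i)).2
      have h3 : k = m 0 + ∑ i : Fin d, m i.succ := by rw [← hs, Fin.sum_univ_succ]
      rw [show k + pval p (complement p f k) =
        m 0 + pval p (complement p f k) + ∑ i : Fin d, m i.succ by omega] at h1
      exact (Nat.dvd_add_left h2).1 h1
    · rw [if_neg hi0, add_zero]
      have h1 : (⟨i, by omega⟩ : Fin (d + 1)) ≠ 0 := fun h => hi0 (by simpa using congrArg Fin.val h)
      have h2 : (⟨i, by omega⟩ : Fin (d + 1)) ≠ Fin.last d := fun h => by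
        have := congrArg Fin.val h
        simp at this
        omega
      have h3 := hm _ h1
      exact ⟨by rw [pval_dig hp]; exact h3.2, fun h => (h3.1 h2).ne' ((dig_eq_zero_iff hp _).1 h)⟩

theorem pval_pos {M : Multiset ℕ} (hp : 2 ≤ p) (h : M ≠ 0) : 0 < pval p M := by
  obtain ⟨x, hx⟩ := Multiset.exists_mem_of_ne_zero h
  have h1 := pow_le_pval (p := p) hx
  have : 0 < p ^ x := by positivity
  omega

/-- Divisibility of the last entry is not part of `Valid`. It follows because the total and all
other blocks are divisible. -/
theorem mem_Utilde_of_valid [NeZero f] (hp : 2 ≤ p) {d k : ℕ} {P : ℕ → Multiset ℕ}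
    (hP : Valid p f (complement p f k) (dig p k) d P) :
    (fun i : Fin (d + 1) => pval p (P i)) ∈ Utilde p (p ^ f) d k := by
  have hcnt : ∀ i : Fin (d + 1), dig p (pval p (P i)) = P i := fun i =>
    dig_pval hp (count_class hP (count_dig_lt hp k) (Nat.lt_succ_iff.1 i.2))
  have hsum : ∑ i : Fin (d + 1), pval p (P i) = k := by
    rw [Fin.sum_univ_eq_sum_range (fun i => pval p (P i)), ← pval_sum, hP.1, pval_dig hp]
  refine mem_Utilde.2 ⟨hsum, ?_, fun i hi => ?_⟩
  · rw [noCarry_iff_dig hp, hsum]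
    simp only [hcnt]
    rw [Fin.sum_univ_eq_sum_range, hP.1]
  · have hlt : ∀ j : Fin (d + 1), j ≠ 0 → j ≠ Fin.last d → DivBlock p f (P j) := by
      intro j hj0 hj
      have h1 : (j : ℕ) ≠ d := fun h => hj (Fin.ext h)
      have h2 := hP.2 j (by omega)
      rwa [if_neg (fun h : (j : ℕ) = 0 => hj0 (Fin.ext h)), add_zero] at h2
    refine ⟨fun hil => pval_pos hp (hlt i hi hil).2, ?_⟩
    by_cases hil : i = Fin.last d
    · have hd : 0 < d := by
        rcases Nat.eq_zero_or_pos d with rfl | h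
        · exact absurd (Fin.ext (Nat.lt_one_iff.1 i.2)) hi
        · exact h
      have h1 : pval p (∑ i ∈ Finset.range (d + 1), (P i + if i = 0 then complement p f k else 0)) =
          k + pval p (complement p f k) := by
        rw [Finset.sum_add_distrib, pval_add, Finset.sum_ite_eq',
          if_pos (Finset.mem_range.2 (by omega)), hP.1, pval_dig hp]
      have h2 := dvd_add_complement (f := f) hp k
      rw [← h1, Finset.sum_range_succ, pval_add, if_neg hd.ne', add_zero, pval_sum] at h2
      rw [hil]
      exact (Nat.dvd_add_right (Finset.dvd_sum fun i hi =>
        (hP.2 i (Finset.mem_range.1 hi)).1)).1 h2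
    · exact (hlt i hi hil).1

theorem weight_classes (hp : 2 ≤ p) {d : ℕ} (m : Fin (d + 1) → ℕ) :
    weight p d (classes p m) = ∑ i : Fin (d + 1), (i : ℕ) * m i := by
  rw [weight, ← Fin.sum_univ_eq_sum_range (fun i => i * pval p (classes p m i))]
  simp only [classes_val, pval_dig hp]

theorem exists_optimal_tuple [NeZero f] (hp : 2 ≤ p) {d k : ℕ}
    (h : (Utilde p (p ^ f) d k).Nonempty) :
    ∃ M ∈ Utilde p (p ^ f) d k, Optimal p f (complement p f k) (dig p k) d (classes p M) := by
  obtain ⟨m, hm⟩ := h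
  obtain ⟨O, hO⟩ := exists_optimal (valid_classes hp hm)
  have hmem := mem_Utilde_of_valid hp hO.1
  refine ⟨_, hmem, valid_classes hp hmem, fun P hP => (hO.2 P hP).trans_eq ?_⟩
  rw [weight_classes hp, weight, ← Fin.sum_univ_eq_sum_range (fun i => i * pval p (O i))]

theorem Optimal.isModest [NeZero f] (hp : 2 ≤ p) {d k : ℕ} {M : Fin (d + 1) → ℕ}
    (hM : M ∈ Utilde p (p ^ f) d k)
    (hO : Optimal p f (complement p f k) (dig p k) d (classes p M)) :
    IsModest (Utilde p (p ^ f) d k) M := by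
  refine ⟨hM, fun m hm hne => ?_⟩
  have hval : ∀ {m : Fin (d + 1) → ℕ} {i : ℕ} (hi : i ≤ d),
      pval p (classes p m i) = m ⟨i, by omega⟩ := fun {m i} hi => by
    rw [classes, dif_pos (by omega), pval_dig hp]
  rcases hO.lex hp (cnt_complement hp k) d _ _ (classes p m) (count_dig_lt hp k)
    (valid_classes hp hm) with h | ⟨j, hj, hlt, h⟩
  · refine absurd (funext fun i => ?_) hne
    have := congrArg (pval p) (h i (Nat.lt_succ_iff.1 i.2))
    rwa [hval (Nat.lt_succ_iff.1 i.2), hval (Nat.lt_succ_iff.1 i.2)] at this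
  · refine ⟨⟨j, by omega⟩, by rwa [hval hj, hval hj] at hlt, fun i hi => ?_⟩
    have hid := Nat.lt_succ_iff.1 i.2
    have := congrArg (pval p) (h i hi hid)
    rwa [hval hid, hval hid] at this

theorem IsModest.eq {n : ℕ} {S : Finset (Fin n → ℕ)} {M N : Fin n → ℕ} (hM : IsModest S M)
    (hN : IsModest S N) : M = N := by
  by_contra hne
  obtain ⟨i, hi, hi'⟩ := hM.2 N hN.1 (Ne.symm hne)
  obtain ⟨j, hj, hj'⟩ := hN.2 M hM.1 hne
  rcases lt_trichotomy i j with h | h | h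
  · have := hi' j h; omega
  · subst h; omega
  · have := hj' i h; omega

/-- An optimal tuple is the only one of its weight. -/
theorem Optimal.weight_lt [NeZero f] (hp : 2 ≤ p) {d k : ℕ} {M : Fin (d + 1) → ℕ}
    (hM : M ∈ Utilde p (p ^ f) d k)
    (hO : Optimal p f (complement p f k) (dig p k) d (classes p M)) {m : Fin (d + 1) → ℕ}
    (hm : m ∈ Utilde p (p ^ f) d k) (hne : m ≠ M) :
    ∑ i : Fin (d + 1), (i : ℕ) * m i < ∑ i : Fin (d + 1), (i : ℕ) * M i := by
  have h1 := hO.2 _ (valid_classes hp hm)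
  rw [← weight_classes hp, ← weight_classes hp]
  refine h1.lt_of_ne fun heq => hne ?_
  -- A tuple of the same weight would be optimal as well, hence also modest, and modest elements are
  -- unique.
  have hOm : Optimal p f (complement p f k) (dig p k) d (classes p m) :=
    ⟨valid_classes hp hm, fun P hP => (hO.2 P hP).trans_eq heq.symm⟩
  exact (hOm.isModest hp hm).eq (hO.isModest hp hM)

theorem snoc_zero_mem {p q d k : ℕ} {m : Fin (d + 1) → ℕ} (hm : m ∈ U p q d k) :
    Fin.snoc (α := fun _ => ℕ) m 0 ∈ Utilde p q (d + 1) k := by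
  obtain ⟨h1, h2, h3⟩ := mem_U.1 hm
  refine mem_Utilde.2 ⟨?_, ?_, fun i hi => ?_⟩
  · rw [Fin.sum_univ_castSucc]
    simpa using h1
  · intro j
    rw [Fin.sum_univ_castSucc]
    simpa using h2 j
  · induction i using Fin.lastCases with
    | last => simp
    | cast i =>
      have h0 : i ≠ 0 := fun h => hi (by rw [h]; rfl)
      simpa using h3 i h0

/-- The modest element has the largest last entry, so it lies in `U` as soon as `U` is nonempty.
Otherwise its last entry is `0`, and `snoc_zero_mem` transfers the comparison to tuples that are one
shorter. -/
theorem IsModest.isModifiedModest {p q d k : ℕ} {M : Fin (d + 1) → ℕ}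
    (h : IsModest (Utilde p q d k) M) : IsModifiedModest p q k d M := by
  cases d with
  | zero =>
    have h0 : Utilde p q 0 k = U p q 0 k := by
      ext m
      rw [mem_U, mem_Utilde]
      have : ∀ i : Fin 1, i = 0 := fun i => Subsingleton.elim _ _
      simp [this]
    rw [h0] at h
    exact h
  | succ d =>
    obtain ⟨hM, hmax⟩ := h
    obtain ⟨h1, h2, h3⟩ := mem_Utilde.1 hM
    by_cases hU : U p q (d + 1) k = ∅
    · have hlast : M (Fin.last (d + 1)) = 0 := by
        by_contra hne
        have : M ∈ U p q (d + 1) k := mem_U.2 ⟨h1, h2, fun i hi => ⟨by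
          by_cases hil : i = Fin.last (d + 1)
          · rw [hil]; omega
          · exact (h3 i hi).1 hil, (h3 i hi).2⟩⟩
        rw [hU] at this
        exact Finset.notMem_empty _ this
      have hsnoc : M = Fin.snoc (α := fun _ => ℕ) (fun i : Fin (d + 1) => M i.castSucc) 0 := by
        funext i
        induction i using Fin.lastCases with
        | last => simp [hlast]
        | cast i => simp
      refine Or.inr ⟨hU, fun i => M i.castSucc, ⟨mem_U.2 ⟨?_, ?_, fun i hi => ?_⟩, ?_⟩, hsnoc⟩
      · rw [Fin.sum_univ_castSucc, hlast, add_zero] at h1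
        exact h1
      · intro j
        have := h2 j
        rw [Fin.sum_univ_castSucc, hlast] at this
        simpa using this
      · have hi0 : i.castSucc ≠ 0 := fun h => hi (Fin.castSucc_eq_zero_iff.1 h)
        exact ⟨(h3 _ hi0).1 (Fin.castSucc_lt_last i).ne, (h3 _ hi0).2⟩
      · intro m hm hne
        obtain ⟨j, hj, hj'⟩ := hmax _ (snoc_zero_mem hm) (fun h => hne (funext fun i => by
          rw [← h]; simp))
        induction j using Fin.lastCases with
        | last => rw [hlast] at hj; omega
        | cast j =>
          refine ⟨j, by simpa using hj, fun i hi => ?_⟩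
          simpa using hj' i.castSucc (Fin.castSucc_lt_castSucc_iff.2 hi)
    · left
      obtain ⟨u, hu⟩ := Finset.nonempty_iff_ne_empty.2 hU
      have hlast : 0 < M (Fin.last (d + 1)) := by
        by_cases huM : u = M
        · rw [← huM]
          exact ((mem_U.1 hu).2.2 _ (Fin.last_pos.ne')).1
        · obtain ⟨j, hj, hj'⟩ := hmax u (U_subset_Utilde hu) huM
          by_cases hjl : j = Fin.last (d + 1)
          · rw [← hjl]; omega
          · rw [← hj' _ (Fin.lt_last_iff_ne_last.2 hjl)]
            exact ((mem_U.1 hu).2.2 _ (Fin.last_pos.ne')).1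
      refine ⟨mem_U.2 ⟨h1, h2, fun i hi => ⟨?_, (h3 i hi).2⟩⟩,
        fun m hm hne => hmax m (U_subset_Utilde hm) hne⟩
      by_cases hil : i = Fin.last (d + 1)
      · rwa [hil]
      · exact (h3 i hi).1 hil

end digits

/-! ### The prime field case `q = p`. -/

section primeField

variable {p f : ℕ}

theorem sum_replace {α : Type*} [AddCommMonoid α] {s : Finset ℕ} {i j : ℕ} (hij : i ≠ j)
    (hi : i ∈ s) (hj : j ∈ s) (g : ℕ → α) (a b : α) :
    ∑ k ∈ s, (if k = i then a else if k = j then b else g k) + (g i + g j) =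
      ∑ k ∈ s, g k + (a + b) := by
  have hj' : j ∈ s.erase i := Finset.mem_erase.2 ⟨hij.symm, hj⟩
  rw [← Finset.add_sum_erase s _ hi, ← Finset.add_sum_erase s g hi,
    ← Finset.add_sum_erase (s.erase i) _ hj', ← Finset.add_sum_erase (s.erase i) g hj']
  rw [if_pos rfl, if_neg hij.symm, if_pos rfl]
  have : ∑ k ∈ (s.erase i).erase j, (if k = i then a else if k = j then b else g k) =
      ∑ k ∈ (s.erase i).erase j, g k := by
    refine Finset.sum_congr rfl fun k hk => ?_
    rw [Finset.mem_erase, Finset.mem_erase] at hk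
    rw [if_neg hk.2.1, if_neg hk.1]
  rw [this]
  ac_rfl

/-- In an optimal division it does not pay to move `S` up in exchange for `T`. -/
theorem Optimal.exchange {E D : Multiset ℕ} {d : ℕ} {O : ℕ → Multiset ℕ}
    (hO : Optimal p f E D d O) {i j : ℕ} (hij : i < j) (hj : j ≤ d) {A B S T : Multiset ℕ}
    (hA : O i = A + S) (hB : O j = B + T) (hAT : DivBlock p f (A + T + if i = 0 then E else 0))
    (hBS : j < d → DivBlock p f (B + S)) : pval p S ≤ pval p T := by
  set P : ℕ → Multiset ℕ := fun k => if k = i then A + T else if k = j then B + S else O k with hP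
  have hi' : i ∈ Finset.range (d + 1) := Finset.mem_range.2 (by omega)
  have hj' : j ∈ Finset.range (d + 1) := Finset.mem_range.2 (by omega)
  have hval : Valid p f E D d P := by
    refine ⟨?_, fun k hk => ?_⟩
    · have h1 := sum_replace hij.ne hi' hj' O (A + T) (B + S)
      rw [hO.1.1, hA, hB] at h1
      refine add_right_cancel (b := A + S + (B + T)) (h1.trans ?_)
      ac_rfl
    · rw [hP]
      by_cases hki : k = i
      · subst hki
        simpa using hAT
      · by_cases hkj : k = j
        · subst hkj
          have hk0 : k ≠ 0 := by omega
          simpa [hij.ne', hk0] using hBS hk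
        · simpa [hki, hkj] using hO.1.2 k hk
  have h1 := hO.2 P hval
  have h3 : weight p d P = ∑ k ∈ Finset.range (d + 1), (if k = i then i * pval p (A + T)
      else if k = j then j * pval p (B + S) else k * pval p (O k)) := by
    refine Finset.sum_congr rfl fun k _ => ?_
    rw [hP]
    by_cases hki : k = i
    · simp [hki]
    · by_cases hkj : k = j
      · simp [hkj, hij.ne']
      · simp [hki, hkj]
  have h2 : weight p d P + (i * pval p (O i) + j * pval p (O j)) =
      weight p d O + (i * pval p (A + T) + j * pval p (B + S)) := by
    rw [h3]
    exact sum_replace hij.ne hi' hj' (fun k => k * pval p (O k)) _ _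
  rw [hA, hB] at h2
  obtain ⟨t, rfl⟩ := Nat.exists_eq_add_of_lt hij
  simp only [pval_add] at h2
  by_contra! hlt
  have h4 := Nat.mul_lt_mul_of_pos_left hlt (Nat.succ_pos t)
  rw [Nat.succ_eq_add_one] at h4
  simp only [add_mul, mul_add, one_mul] at h2 h4
  omega

theorem pval_modEq_card (hp : 2 ≤ p) (M : Multiset ℕ) : pval p M ≡ M.card [MOD p - 1] := by
  induction M using Multiset.induction_on with
  | empty => rfl
  | cons a M ih =>
    rw [← Multiset.singleton_add, pval_add, Multiset.card_add, pval_singleton,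
      Multiset.card_singleton]
    refine Nat.ModEq.add ?_ ih
    have : p ≡ 1 [MOD p - 1] := ((Nat.modEq_iff_dvd' (by omega)).2 dvd_rfl).symm
    simpa using this.pow a

theorem divBlock_one_iff (hp : 2 ≤ p) {M : Multiset ℕ} :
    DivBlock p 1 M ↔ (p - 1) ∣ M.card ∧ M ≠ 0 := by
  rw [DivBlock, pow_one, (pval_modEq_card hp M).dvd_iff dvd_rfl]

/-- Swapping two single positions preserves cardinalities, hence blocks, so it must not raise the
weight. -/
theorem Optimal.sorted (hp : 2 ≤ p) {E D : Multiset ℕ} {d : ℕ} {O : ℕ → Multiset ℕ}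
    (hO : Optimal p 1 E D d O) {i j x y : ℕ} (hij : i < j) (hj : j ≤ d) (hx : x ∈ O i)
    (hy : y ∈ O j) : x ≤ y := by
  obtain ⟨A, hA⟩ := Multiset.exists_cons_of_mem hx
  obtain ⟨B, hB⟩ := Multiset.exists_cons_of_mem hy
  have h := hO.exchange hij hj (A := A) (S := {x}) (B := B) (T := {y})
    (by rw [hA, Multiset.add_comm, Multiset.singleton_add])
    (by rw [hB, Multiset.add_comm, Multiset.singleton_add])
    (by
      have h1 := (divBlock_one_iff hp).1 (hO.1.2 i (by omega))
      rw [hA] at h1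
      refine (divBlock_one_iff hp).2 ⟨?_, ?_⟩
      · simpa [add_right_comm] using h1.1
      · intro h0
        simpa using congrArg (Multiset.count y) h0)
    (fun hjd => by
      have h1 := (divBlock_one_iff hp).1 (hO.1.2 j hjd)
      rw [hB, if_neg (by omega), add_zero] at h1
      refine (divBlock_one_iff hp).2 ⟨?_, ?_⟩
      · simpa using h1.1
      · intro h0
        simpa using congrArg (Multiset.count x) h0)
  rw [pval_singleton, pval_singleton] at h
  exact (Nat.pow_le_pow_iff_right (by omega)).1 h

/-- Moving `p - 1` positions one class up preserves divisibility and raises the weight. Only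
emptying the class can make this illegal. -/
theorem Optimal.eq_zero_of_card (hp : 2 ≤ p) {E D : Multiset ℕ} {d : ℕ} {O : ℕ → Multiset ℕ}
    (hO : Optimal p 1 E D d O) {i : ℕ} (hi : i < d) {A S : Multiset ℕ} (hA : O i = A + S)
    (hS : S.card = p - 1) : A + (if i = 0 then E else 0) = 0 := by
  by_contra hne
  have h1 := (divBlock_one_iff hp).1 (hO.1.2 i hi)
  have h := hO.exchange (Nat.lt_succ_self i) hi hA (add_zero (O (i + 1))).symm
    (by
      refine (divBlock_one_iff hp).2 ⟨?_, by simpa using hne⟩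
      have h2 := h1.1
      rw [hA, add_right_comm, Multiset.card_add _ S, hS, Nat.dvd_add_self_right] at h2
      simpa using h2)
    (fun hjd => by
      have h2 := (divBlock_one_iff hp).1 (hO.1.2 (i + 1) hjd)
      rw [if_neg (by omega), add_zero] at h2
      refine (divBlock_one_iff hp).2 ⟨?_, fun h0 => h2.2 (add_eq_zero.1 h0).1⟩
      rw [Multiset.card_add, hS, Nat.dvd_add_self_right]
      exact h2.1)
  have hS0 : S ≠ 0 := fun h0 => by
    rw [h0, Multiset.card_zero] at hS
    omega
  have := pval_pos hp hS0
  rw [pval_zero] at h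
  omega

theorem exists_add_card {M : Multiset ℕ} {n : ℕ} (h : n ≤ M.card) :
    ∃ A S : Multiset ℕ, M = A + S ∧ S.card = n := by
  obtain ⟨S, hS⟩ := Multiset.card_pos_iff_exists_mem.1
    (by rw [Multiset.card_powersetCard]; exact Nat.choose_pos h :
      0 < (Multiset.powersetCard n M).card)
  obtain ⟨h1, h2⟩ := Multiset.mem_powersetCard.1 hS
  obtain ⟨A, rfl⟩ := Multiset.le_iff_exists_add.1 h1
  exact ⟨A, S, Multiset.add_comm _ _, h2⟩

theorem Optimal.card_zero_lt (hp : 2 ≤ p) {E D : Multiset ℕ} {d : ℕ} {O : ℕ → Multiset ℕ}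
    (hO : Optimal p 1 E D d O) (hE : E ≠ 0) (hd : 0 < d) : (O 0).card < p - 1 := by
  by_contra! hle
  obtain ⟨A, S, hA, hS⟩ := exists_add_card hle
  have := hO.eq_zero_of_card hp hd hA hS
  rw [if_pos rfl, add_eq_zero] at this
  exact hE this.2

theorem Optimal.card_eq (hp : 2 ≤ p) {E D : Multiset ℕ} {d : ℕ} {O : ℕ → Multiset ℕ}
    (hO : Optimal p 1 E D d O) {i : ℕ} (hi0 : i ≠ 0) (hi : i < d) : (O i).card = p - 1 := by
  obtain ⟨⟨c, hc⟩, hne⟩ := (divBlock_one_iff hp).1 (hO.1.2 i hi)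
  rw [if_neg hi0, add_zero] at hc hne
  have hpos := Multiset.card_pos.2 hne
  have hc0 : 1 ≤ c := Nat.pos_of_ne_zero fun h => by simp [h] at hc; exact hne hc
  have hle : (p - 1) * 1 ≤ (O i).card := hc ▸ Nat.mul_le_mul_left _ hc0
  rw [mul_one] at hle
  obtain ⟨A, S, hA, hS⟩ := exists_add_card hle
  have := hO.eq_zero_of_card hp hi hA hS
  rw [if_neg hi0, add_zero] at this
  rw [hA, this, zero_add, hS]

/-- Equal cardinality would give some `x < e` with more copies in `A` than in `B`. A copy of `x`
then lies in `B'`, below `e ∈ B`. -/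
theorem not_topLT_of_lowest {A A' B B' : Multiset ℕ} (h : A + A' = B + B')
    (hc : A.card = B.card) (hB : ∀ x ∈ B, ∀ y ∈ B', x ≤ y) (e : ℕ) : ¬ TopLT A B e := by
  intro he
  have hcount : ∀ x, A.count x + A'.count x = B.count x + B'.count x := fun x => by
    rw [← Multiset.count_add, h, Multiset.count_add]
  obtain ⟨x, hxe, hx⟩ : ∃ x < e, B.count x < A.count x := by
    by_contra! hall
    have hle : A ≤ B := Multiset.le_iff_count.2 fun x => by
      rcases lt_trichotomy x e with hx | rfl | hx
      · exact hall x hx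
      · exact he.1.le
      · exact (he.2 x hx).le
    have := Multiset.eq_of_le_of_card_le hle hc.ge
    exact absurd he.1 (by rw [this]; exact lt_irrefl _)
  have h1 : e ∈ B := Multiset.count_pos.1 (by have := he.1; omega)
  have h2 : x ∈ B' := Multiset.count_pos.1 (by have := hcount x; omega)
  have := hB e h1 x h2
  omega

theorem eq_of_lowest {A A' B B' : Multiset ℕ} (h : A + A' = B + B')
    (hc : A.card = B.card) (hA : ∀ x ∈ A, ∀ y ∈ A', x ≤ y) (hB : ∀ x ∈ B, ∀ y ∈ B', x ≤ y) :
    A = B := by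
  by_contra hne
  obtain ⟨e, he | he⟩ := exists_topLT hne
  · exact not_topLT_of_lowest h hc hB e he
  · exact not_topLT_of_lowest h.symm hc.symm hA e he

theorem sum_split {d i : ℕ} (hi : i ≤ d) (P : ℕ → Multiset ℕ) :
    ∑ k ∈ Finset.range (d + 1), P k =
      ∑ k ∈ Finset.range i, P k + (P i + ∑ k ∈ Finset.Ico (i + 1) (d + 1), P k) := by
  rw [← add_assoc, ← Finset.sum_range_succ, Finset.sum_range_add_sum_Ico _ (by omega)]

/-- Class `0` has fewer than `p - 1` positions and a prescribed residue, and the next classes have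
exactly `p - 1`. By `Optimal.sorted`, each class consists of the lowest positions still left, so `O`
and `N` agree inductively. -/
theorem Optimal.eq_of_lt (hp : 2 ≤ p) {E D : Multiset ℕ} {d : ℕ} {O N : ℕ → Multiset ℕ}
    (hE : E ≠ 0) (hO : Optimal p 1 E D (d + 1) O) (hN : Optimal p 1 E D d N) (i : ℕ) :
    i < d → O i = N i := by
  induction i using Nat.strong_induction_on with
  | _ i ih =>
    intro hi
    have hs := hO.1.1.trans hN.1.1.symm
    rw [sum_split (by omega : i ≤ d + 1), sum_split hi.le,
      Finset.sum_congr rfl fun k hk => ih k (Finset.mem_range.1 hk)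
        ((Finset.mem_range.1 hk).trans hi)] at hs
    refine eq_of_lowest (add_left_cancel hs) ?_ ?_ ?_
    · by_cases hi0 : i = 0
      · subst hi0
        have h1 := ((divBlock_one_iff hp).1 (hO.1.2 0 (by omega))).1
        have h2 := ((divBlock_one_iff hp).1 (hN.1.2 0 hi)).1
        rw [if_pos rfl, Multiset.card_add] at h1 h2
        have h3 : (O 0).card ≡ (N 0).card [MOD p - 1] :=
          Nat.ModEq.add_right_cancel' E.card
            (((Nat.modEq_zero_iff_dvd.2 h1)).trans (Nat.modEq_zero_iff_dvd.2 h2).symm)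
        exact Nat.ModEq.eq_of_lt_of_lt h3 (hO.card_zero_lt hp hE (by omega))
          (hN.card_zero_lt hp hE hi)
      · rw [hO.card_eq hp hi0 (by omega), hN.card_eq hp hi0 hi]
    · intro x hx y hy
      obtain ⟨k, hk, hyk⟩ := Multiset.mem_sum.1 hy
      rw [Finset.mem_Ico] at hk
      exact hO.sorted hp (by omega) (by omega) hx hyk
    · intro x hx y hy
      obtain ⟨k, hk, hyk⟩ := Multiset.mem_sum.1 hy
      rw [Finset.mem_Ico] at hk
      exact hN.sorted hp (by omega) (by omega) hx hyk

theorem Optimal.isSplitOfModest (hp : 2 ≤ p) {d k : ℕ} {M : Fin (d + 1) → ℕ}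
    (hM : M ∈ Utilde p (p ^ 1) d k)
    (hO : Optimal p 1 (complement p 1 k) (dig p k) d (classes p M)) :
    IsSplitOfModest p (p ^ 1) k d M := by
  cases d with
  | zero => trivial
  | succ d =>
    set O := classes p M with hOdef
    -- Merging the last two classes gives a valid division `T`. It agrees with the optimal `N` below
    -- `d` by `Optimal.eq_of_lt`, hence also in its last class.
    set T := withTop d O (O d + O (d + 1)) with hT
    have hsum := hO.1.1
    rw [Finset.sum_range_succ, Finset.sum_range_succ, add_assoc] at hsum
    have hTval : Valid p 1 (complement p 1 k) (dig p k) d T :=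
      valid_withTop hsum fun i hi => hO.1.2 i (by omega)
    have hTmem := mem_Utilde_of_valid hp hTval
    obtain ⟨N, hN, hNO⟩ := exists_optimal_tuple hp ⟨_, hTmem⟩
    have hpO : ∀ (i : ℕ) (hi : i < d + 2), pval p (O i) = M ⟨i, hi⟩ := fun i hi => by
      rw [hOdef, classes, dif_pos hi, pval_dig hp]
    have hTmerge : (fun i : Fin (d + 1) => pval p (T i)) = fun i : Fin (d + 1) =>
        if i = Fin.last d then M i.castSucc + M (Fin.last (d + 1)) else M i.castSucc := by
      funext i
      by_cases hi : i = Fin.last d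
      · subst hi
        rw [if_pos rfl, hT, withTop, if_neg (by simp), pval_add, hpO d (by omega),
          hpO (d + 1) (by omega)]
        rfl
      · have hlt : (i : ℕ) < d := by
          have := Fin.lt_last_iff_ne_last.2 hi
          exact this
        rw [if_neg hi, hT, withTop, if_pos hlt, hpO i (by omega)]
        rfl
    have hNT : ∀ i ≤ d, T i = classes p N i := by
      have hlt : ∀ i < d, T i = classes p N i := fun i hi => by
        rw [hT, withTop, if_pos hi]
        exact hO.eq_of_lt hp (complement_ne_zero hp k) hNO i hi
      intro i hi
      rcases hi.lt_or_eq with h | rfl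
      · exact hlt i h
      · have h1 := hTval.1.trans hNO.1.1.symm
        rw [Finset.sum_range_succ, Finset.sum_range_succ (classes p N),
          Finset.sum_congr rfl fun k hk => hlt k (Finset.mem_range.1 hk)] at h1
        exact add_left_cancel h1
    have hTN : (fun i : Fin (d + 1) => pval p (T i)) = N := by
      funext i
      rw [hNT i (Nat.lt_succ_iff.1 i.2), classes_val, pval_dig hp]
    have hmod := hNO.isModest hp hN
    rw [IsSplitOfModest, ← hTmerge, hTN]
    refine ⟨mem_U.2 ?_, fun m hm hne => hmod.2 m (U_subset_Utilde hm) hne⟩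
    obtain ⟨h1, h2, h3⟩ := mem_Utilde.1 hN
    refine ⟨h1, h2, fun i hi => ⟨?_, (h3 i hi).2⟩⟩
    by_cases hil : i = Fin.last d
    · have h4 := congrFun (hTN.symm.trans hTmerge) i
      rw [h4, if_pos hil]
      have h5 : i.castSucc ≠ 0 := fun h => hi (Fin.castSucc_eq_zero_iff.1 h)
      have := ((mem_Utilde.1 hM).2.2 i.castSucc h5).1 (Fin.castSucc_lt_last i).ne
      omega
    · exact (h3 i hi).1 hil

end primeField

/-! ### Multinomial coefficients mod `p`. -/

section multinomial

open Nat

theorem sum_div_le_div {ι : Type*} (s : Finset ι) (m : ι → ℕ) {c : ℕ} (hc : 0 < c) :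
    ∑ j ∈ s, m j / c ≤ (∑ j ∈ s, m j) / c := by
  rw [Nat.le_div_iff_mul_le hc, Finset.sum_mul]
  exact Finset.sum_le_sum fun j _ => Nat.div_mul_le_self _ _

theorem noCarry_iff_div {p n : ℕ} (hp : 0 < p) (m : Fin n → ℕ) :
    NoCarry p m ↔ ∀ i, (∑ j, m j) / p ^ i = ∑ j, m j / p ^ i := by
  have key : ∀ i, ∑ j, m j / p ^ i = p * (∑ j, m j / p ^ (i + 1)) + ∑ j, m j / p ^ i % p := by
    intro i
    rw [Finset.mul_sum, ← Finset.sum_add_distrib]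
    refine Finset.sum_congr rfl fun j _ => ?_
    rw [pow_succ, ← Nat.div_div_eq_div_mul, Nat.div_add_mod]
  constructor
  · intro h i
    induction i with
    | zero => simp
    | succ i ih =>
      rw [pow_succ, ← Nat.div_div_eq_div_mul, ih, key i, Nat.mul_add_div hp,
        Nat.div_eq_of_lt (h i), add_zero, pow_succ]
  · intro h i
    have h1 := key i
    rw [← h i, ← h (i + 1), pow_succ, ← Nat.div_div_eq_div_mul] at h1
    have h2 := Nat.div_add_mod ((∑ j, m j) / p ^ i) p
    have h3 := Nat.mod_lt ((∑ j, m j) / p ^ i) hp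
    omega

/-- By Legendre the valuation is `∑_i (⌊k / p ^ i⌋ - ∑_j ⌊m_j / p ^ i⌋)` over `i ≥ 1`. Its terms are
nonnegative, so it vanishes iff they all do. -/
theorem not_dvd_multinomial_iff {p n : ℕ} [hp : Fact p.Prime] (m : Fin n → ℕ) :
    ¬ p ∣ Nat.multinomial Finset.univ m ↔ NoCarry p m := by
  have hp0 := hp.out.pos
  rw [noCarry_iff_div hp0]
  set k := ∑ j, m j with hk
  have hle : ∀ i, ∑ j, m j / p ^ i ≤ k / p ^ i := fun i =>
    sum_div_le_div _ _ (pow_pos hp0 i)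
  have hne : Nat.multinomial Finset.univ m ≠ 0 := (Nat.multinomial_pos _ _).ne'
  have hb : ∀ l ≤ k, padicValNat p l ! = ∑ i ∈ Finset.Ico 1 (Nat.log p k + 1), l / p ^ i :=
    fun l hl => padicValNat_factorial (Nat.lt_succ_of_le (Nat.log_mono_right hl))
  have hval : padicValNat p (Nat.multinomial Finset.univ m) +
      ∑ i ∈ Finset.Ico 1 (Nat.log p k + 1), ∑ j, m j / p ^ i =
      ∑ i ∈ Finset.Ico 1 (Nat.log p k + 1), k / p ^ i := by
    have h := congrArg (fun x => x.factorization p) (Nat.multinomial_spec Finset.univ m)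
    rw [Nat.factorization_mul (Finset.prod_ne_zero_iff.2 fun j _ => Nat.factorial_ne_zero _) hne,
      Nat.factorization_prod fun j _ => Nat.factorial_ne_zero _] at h
    simp only [Finsupp.coe_add, Finsupp.coe_finsetSum, Pi.add_apply, Finset.sum_apply,
      Nat.factorization_def _ hp.out] at h
    rw [hb _ le_rfl, Finset.sum_congr rfl fun j _ => hb (m j)
      (Finset.single_le_sum (fun i _ => Nat.zero_le (m i)) (Finset.mem_univ j)),
      Finset.sum_comm] at h
    omega
  have hdvd : ¬ p ∣ Nat.multinomial Finset.univ m ↔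
      padicValNat p (Nat.multinomial Finset.univ m) = 0 := by
    rw [padicValNat.eq_zero_iff]
    have := hp.out.ne_one
    tauto
  rw [hdvd]
  constructor
  · intro h i
    rw [h, zero_add, Finset.sum_eq_sum_iff_of_le fun i _ => hle i] at hval
    rcases Nat.eq_zero_or_pos i with rfl | hi
    · simp [hk]
    by_cases hik : i < Nat.log p k + 1
    · exact (hval i (Finset.mem_Ico.2 ⟨hi, hik⟩)).symm
    · have h0 : k / p ^ i = 0 :=
        Nat.div_eq_of_lt (Nat.lt_pow_of_log_lt hp.out.one_lt (by omega))
      have := hle i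
      omega
  · intro h
    rw [Finset.sum_congr rfl fun i _ => (h i).symm] at hval
    omega

end multinomial

/-! ### Expansion of the power sum. -/

section expansion

open Polynomial

variable {F : Type*} [Field F]

theorem sum_pow_erase_zero [Fintype F] [DecidableEq F] (m : ℕ) :
    ∑ x ∈ Finset.univ.erase (0 : F), x ^ m =
      if (Fintype.card F - 1) ∣ m then -1 else 0 := by
  rw [← FiniteField.sum_pow_units F m]
  symm
  refine Finset.sum_bij (fun x _ => (x : F)) ?_ ?_ ?_ ?_
  · simp
  · intro a _ b _ h
    exact Units.ext h
  · intro b hb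
    exact ⟨Units.mk0 b (Finset.ne_of_mem_erase hb), Finset.mem_univ _, rfl⟩
  · simp

theorem sum_pow_univ [Fintype F] (m : ℕ) :
    ∑ x : F, x ^ m = if 0 < m ∧ (Fintype.card F - 1) ∣ m then -1 else 0 := by
  classical
  rw [← Finset.add_sum_erase _ _ (Finset.mem_univ (0 : F)), sum_pow_erase_zero]
  rcases Nat.eq_zero_or_pos m with rfl | hm
  · simp
  · simp [hm, hm.ne']

open Classical in
/-- The possible values of the `i`-th coefficient (from the top) of a monic polynomial of degree `d`
that is prime to `X`. -/
noncomputable def coeffRange (F : Type*) [Field F] [Fintype F] {d : ℕ} (i : Fin (d + 1)) :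
    Finset F :=
  Finset.univ.filter fun x => (i = 0 → x = 1) ∧ (i = Fin.last d → x ≠ 0)

-- The constant coefficient runs over nonzero elements only, so for `d ≥ 1` its exponent `0`
-- contributes `q - 1 = -1` instead of `q = 0`. This is why `Utilde` allows a zero last entry.
open Classical in
theorem sum_coeffRange [Fintype F] {d : ℕ} (i : Fin (d + 1)) (m : ℕ) :
    ∑ x ∈ coeffRange F i, x ^ m = if i = 0 then 1 else
      if (i ≠ Fin.last d → 0 < m) ∧ (Fintype.card F - 1) ∣ m then -1 else 0 := by
  by_cases h0 : i = 0
  · have : coeffRange F i = {1} := by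
      ext x
      simp only [coeffRange, h0, Finset.mem_filter, Finset.mem_univ, true_and, true_implies,
        Finset.mem_singleton]
      constructor
      · exact fun h => h.1
      · rintro rfl
        exact ⟨rfl, fun _ => one_ne_zero⟩
    rw [this, if_pos h0]
    simp
  · rw [if_neg h0]
    by_cases h1 : i = Fin.last d
    · have : coeffRange F i = Finset.univ.erase 0 := by
        ext x
        simp [coeffRange, h1 ▸ h0, h1]
      rw [this, sum_pow_erase_zero]
      simp [h1]
    · have : coeffRange F i = Finset.univ := by
        ext x
        simp [coeffRange, h0, h1]
      rw [this, sum_pow_univ]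
      simp [h1]

/-- The polynomial of degree at most `d` with the coefficients `θ`, from the top. -/
noncomputable def ofCoeffs {d : ℕ} (θ : Fin (d + 1) → F) : F[X] :=
  ∑ i : Fin (d + 1), C (θ i) * X ^ (d - (i : ℕ))

theorem coeff_ofCoeffs {d : ℕ} (θ : Fin (d + 1) → F) (i : Fin (d + 1)) :
    (ofCoeffs θ).coeff (d - i) = θ i := by
  rw [ofCoeffs, finsetSum_coeff, Finset.sum_eq_single i]
  · simp
  · intro j _ hj
    rw [coeff_C_mul_X_pow, if_neg]
    intro h
    exact hj (Fin.ext (by omega))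
  · simp

theorem coeff_ofCoeffs_of_lt {d n : ℕ} (θ : Fin (d + 1) → F) (h : d < n) :
    (ofCoeffs θ).coeff n = 0 := by
  rw [ofCoeffs, finsetSum_coeff]
  refine Finset.sum_eq_zero fun i _ => ?_
  rw [coeff_C_mul_X_pow, if_neg (by omega)]

theorem isCoprime_X_iff (a : F[X]) : IsCoprime a X ↔ a.coeff 0 ≠ 0 := by
  rw [isCoprime_comm, irreducible_X.coprime_iff_not_dvd, X_dvd_iff]

theorem sum_monic_coprime [Fintype F] {R : Type*} [AddCommMonoid R] (d : ℕ) (g : F[X] → R) :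
    ∑ a ∈ (finite_monic_coprime (X : F[X]) d).toFinset, g a =
      ∑ θ ∈ Fintype.piFinset fun i : Fin (d + 1) => coeffRange F i, g (ofCoeffs θ) := by
  symm
  refine Finset.sum_nbij' ofCoeffs (fun a i => a.coeff (d - i)) ?_ ?_ ?_ ?_ ?_
  · intro θ hθ
    simp only [Fintype.mem_piFinset, coeffRange, Finset.mem_filter, Finset.mem_univ,
      true_and] at hθ
    have h1 : (ofCoeffs θ).coeff d = 1 := by
      simpa [(hθ 0).1 rfl] using coeff_ofCoeffs θ 0
    have h2 : (ofCoeffs θ).coeff 0 ≠ 0 := by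
      have := coeff_ofCoeffs θ (Fin.last d)
      rw [Fin.val_last, Nat.sub_self] at this
      rw [this]
      exact (hθ (Fin.last d)).2 rfl
    have h3 : (ofCoeffs θ).natDegree ≤ d :=
      natDegree_le_iff_coeff_eq_zero.2 fun n hn => coeff_ofCoeffs_of_lt θ hn
    rw [Set.Finite.mem_toFinset]
    exact ⟨monic_of_natDegree_le_of_coeff_eq_one d h3 h1,
      natDegree_eq_of_le_of_coeff_ne_zero h3 (by simp [h1]), (isCoprime_X_iff _).2 h2⟩
  · intro a ha
    rw [Set.Finite.mem_toFinset] at ha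
    obtain ⟨h1, h2, h3⟩ := ha
    simp only [Fintype.mem_piFinset, coeffRange, Finset.mem_filter, Finset.mem_univ, true_and]
    refine fun i => ⟨?_, ?_⟩
    · rintro rfl
      rw [Fin.val_zero, Nat.sub_zero, ← h2]
      exact h1.coeff_natDegree
    · rintro rfl
      rw [Fin.val_last, Nat.sub_self]
      exact (isCoprime_X_iff _).1 h3
  · intro θ _
    funext i
    exact coeff_ofCoeffs θ i
  · intro a ha
    rw [Set.Finite.mem_toFinset] at ha
    obtain ⟨h1, h2, h3⟩ := ha
    ext n
    by_cases hn : d < n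
    · rw [coeff_ofCoeffs_of_lt _ hn, coeff_eq_zero_of_natDegree_lt (by omega)]
    · have h := coeff_ofCoeffs (fun i : Fin (d + 1) => a.coeff (d - i)) ⟨d - n, by omega⟩
      simp only at h
      rwa [Nat.sub_sub_self (not_lt.1 hn)] at h
  · intro θ _
    rfl

open Classical in
theorem prod_sum_coeffRange [Fintype F] {d : ℕ} (m : Fin (d + 1) → ℕ) :
    ∏ i, ∑ x ∈ coeffRange F i, x ^ m i =
      if ∀ i, i ≠ 0 → (i ≠ Fin.last d → 0 < m i) ∧ (Fintype.card F - 1) ∣ m i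
      then (-1) ^ d else 0 := by
  simp only [sum_coeffRange]
  split_ifs with h
  · rw [Fin.prod_univ_succ, if_pos rfl, one_mul, Finset.prod_congr rfl fun i _ => by
      rw [if_neg (Fin.succ_ne_zero i), if_pos (h _ (Fin.succ_ne_zero i))]]
    simp
  · push Not at h
    obtain ⟨i, hi, h⟩ := h
    refine Finset.prod_eq_zero (Finset.mem_univ i) ?_
    rw [if_neg hi, if_neg]
    exact fun h' => h h'.1 h'.2

theorem ofCoeffs_pow {d : ℕ} (θ : Fin (d + 1) → F) (k : ℕ) :
    ofCoeffs θ ^ k = ∑ m ∈ Finset.piAntidiag Finset.univ k,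
      C (∏ i, θ i ^ m i) * ((Nat.multinomial Finset.univ m : F[X]) *
        X ^ (∑ i : Fin (d + 1), (d - (i : ℕ)) * m i)) := by
  rw [ofCoeffs, Finset.sum_pow_eq_sum_piAntidiag]
  refine Finset.sum_congr rfl fun m _ => ?_
  simp only [mul_pow, Finset.prod_mul_distrib, map_prod, map_pow, ← pow_mul,
    Finset.prod_pow_eq_pow_sum]
  ring

theorem natCast_multinomial_ne_zero_iff (p : ℕ) [Fact p.Prime] [CharP F p] {d : ℕ}
    (m : Fin (d + 1) → ℕ) : (Nat.multinomial Finset.univ m : F) ≠ 0 ↔ NoCarry p m := by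
  rw [Ne, CharP.cast_eq_zero_iff F p, not_dvd_multinomial_iff]

theorem sum_pow_monic_coprime [Fintype F] (p : ℕ) [Fact p.Prime] [CharP F p] (d k : ℕ) :
    ∑ a ∈ (finite_monic_coprime (X : F[X]) d).toFinset, a ^ k =
      ∑ m ∈ Utilde p (Fintype.card F) d k, summand F m := by
  classical
  rw [sum_monic_coprime]
  simp only [ofCoeffs_pow]
  rw [Finset.sum_comm, Utilde, Finset.sum_filter]
  refine Finset.sum_congr rfl fun m _ => ?_
  rw [← Finset.sum_mul, ← map_sum, ← Finset.prod_univ_sum (fun i => coeffRange F i)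
    (fun i x => x ^ m i), prod_sum_coeffRange]
  by_cases h1 : NoCarry p m
  · simp only [h1, true_and]
    split_ifs
    · simp [summand, mul_assoc]
    · simp
  · simp only [h1, false_and, if_false]
    have h2 : (Nat.multinomial Finset.univ m : F) = 0 := by
      by_contra h
      exact h1 ((natCast_multinomial_ne_zero_iff p m).1 h)
    rw [← C_eq_natCast, h2]
    simp

theorem primeToPowerSum_eq [Fintype F] (p : ℕ) [Fact p.Prime] [CharP F p] (d : ℕ) {s : ℤ}
    (hs : s < 0) :
    primeToPowerSum (X : F[X]) d s = ∑ m ∈ Utilde p (Fintype.card F) d (-s).toNat,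
      algebraMap F[X] (RatFunc F) (summand F m) := by
  rw [← map_sum, ← sum_pow_monic_coprime, map_sum, primeToPowerSum]
  refine Finset.sum_congr rfl fun a _ => ?_
  rw [one_div, ← zpow_neg, map_pow, ← zpow_natCast, Int.toNat_of_nonneg (by omega)]

theorem summand_eq {d : ℕ} (m : Fin (d + 1) → ℕ) :
    summand F m = C ((-1) ^ d * (Nat.multinomial Finset.univ m : F)) *
      X ^ (∑ i : Fin (d + 1), (d - (i : ℕ)) * m i) := by
  simp [summand]

variable {p : ℕ} [Fact p.Prime] [CharP F p] {q d k : ℕ} {m : Fin (d + 1) → ℕ}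

theorem summand_ne_zero (h : m ∈ Utilde p q d k) : summand F m ≠ 0 := by
  rw [summand_eq]
  refine mul_ne_zero (C_ne_zero.2 (mul_ne_zero (pow_ne_zero _ (neg_ne_zero.2 one_ne_zero)) ?_))
    (pow_ne_zero _ X_ne_zero)
  exact (natCast_multinomial_ne_zero_iff p m).2 (mem_Utilde.1 h).2.1

/-- This turns minimal degree into maximal weight. -/
theorem natDegree_summand_add (h : m ∈ Utilde p q d k) :
    (summand F m).natDegree + ∑ i : Fin (d + 1), (i : ℕ) * m i = d * k := by
  rw [summand_eq, natDegree_C_mul_X_pow, ← (mem_Utilde.1 h).1, Finset.mul_sum,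
    ← Finset.sum_add_distrib]
  · refine Finset.sum_congr rfl fun i _ => ?_
    rw [← add_mul, Nat.sub_add_cancel (Nat.lt_succ_iff.1 i.2)]
  · exact mul_ne_zero (pow_ne_zero _ (neg_ne_zero.2 one_ne_zero))
      ((natCast_multinomial_ne_zero_iff p m).2 (mem_Utilde.1 h).2.1)

end expansion

end VadicPowerSum

theorem mainTheorem6 {F : Type*} [Field F] [Fintype F] (p : ℕ) [Fact p.Prime] [CharP F p]
    (d : ℕ) (s : ℤ) (hs : s < 0)
    (hS : VadicPowerSum.primeToPowerSum (Polynomial.X : Polynomial F) d s ≠ 0) :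
    -- the expansion of the power sum, all of whose summands are nonzero monomials
    VadicPowerSum.primeToPowerSum (Polynomial.X : Polynomial F) d s =
        ∑ m ∈ VadicPowerSum.Utilde p (Fintype.card F) d (-s).toNat,
          algebraMap (Polynomial F) (RatFunc F) (VadicPowerSum.summand F m) ∧
    (∀ m ∈ VadicPowerSum.Utilde p (Fintype.card F) d (-s).toNat,
        VadicPowerSum.summand F m ≠ 0) ∧
    -- exactly one summand has minimal degree, and it is the one described
    ∃ M ∈ VadicPowerSum.Utilde p (Fintype.card F) d (-s).toNat,
      (∀ m ∈ VadicPowerSum.Utilde p (Fintype.card F) d (-s).toNat, m ≠ M →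
        (VadicPowerSum.summand F M).natDegree < (VadicPowerSum.summand F m).natDegree) ∧
      VadicPowerSum.IsModifiedModest p (Fintype.card F) (-s).toNat d M ∧
      (Fintype.card F = p → VadicPowerSum.IsSplitOfModest p (Fintype.card F) (-s).toNat d M) := by
  have hp : 2 ≤ p := (Fact.out : p.Prime).two_le
  obtain ⟨f, -, hf⟩ := FiniteField.card F p
  have : NeZero (f : ℕ) := ⟨f.ne_zero⟩
  have hexp := VadicPowerSum.primeToPowerSum_eq (F := F) p d hs
  refine ⟨hexp, fun m hm => VadicPowerSum.summand_ne_zero hm, ?_⟩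
  rw [hexp] at hS
  -- Nonvanishing of the power sum provides an element of the index set, and so an optimal tuple.
  obtain ⟨m₀, hm₀, -⟩ := Finset.exists_ne_zero_of_sum_ne_zero hS
  rw [hf] at hm₀ ⊢
  obtain ⟨M, hM, hO⟩ := VadicPowerSum.exists_optimal_tuple hp ⟨m₀, hm₀⟩
  refine ⟨M, hM, fun m hm hne => ?_, (hO.isModest hp hM).isModifiedModest, fun hq => ?_⟩
  · have h1 := VadicPowerSum.natDegree_summand_add (F := F) hm
    have h2 := VadicPowerSum.natDegree_summand_add (F := F) hM
    have h3 := hO.weight_lt hp hM hm hne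
    omega
  · have hf1 : (f : ℕ) = 1 := Nat.pow_right_injective hp (by simpa using hq)
    rw [hf1] at hM hO ⊢
    exact hO.isSplitOfModest hp hM
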